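/- Let $G$ be an affine algebraic group over $\mathbb{C}$ and let $\tilde U$, $U$ be finite-dimensional $G$-modules, with bases of their duals denoted $x_1,\dots,x_m$ and $y_1,\dots,y_n$. For an affine scheme $X$ over $\mathbb C$ let $J_\infty(X)$ be its arc space, $\mathrm{Hom}(\mathrm{Spec}\,A, J_\infty(X)) = \mathrm{Hom}(\mathrm{Spec}\,A[[t]],X)$. Put $$S^{\tilde U}=\mathbb{C}[x_{i,j}\mid 1\le i\le m,\ j\ge 0],\qquad L^U=\textstyle\bigwedge\big(\bigoplus_{1\le i\le n,\ j\ge 0}\mathbb{C}\,y_{i,j}\big),$$ and let $D$ be the even derivation of the superalgebra $S^{\tilde U}\otimes L^U$ with $D x_{i,j}=(j+1)x_{i,j+1}$ and $Dy_{i,j}=(j+1)y_{i,j+1}$. The group $J_\infty(G)$ acts on $S^{\tilde U}\otimes L^U$ by algebra automorphisms through the action on arcs $x_i(t)=\sum_j x_{i,j}t^j$, $y_i(t)=\sum_j y_{i,j}t^j$: if $g\in G$ acts on coordinates by $x_i\mapsto\sum_k a_{ik}(g)x_k$ and $y_i\mapsto \sum_k b_{ik}(g)y_k$, then $g(t)\in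 J_\infty(G)$ acts by $x_i(t)\mapsto\sum_k a_{ik}(g(t))x_k(t)$ and $y_i(t)\mapsto\sum_k b_{ik}(g(t))y_k(t)$. Let $S^{\tilde U}_0\otimes L^U_0\subseteq S^{\tilde U}\otimes L^U$ be the subalgebra generated by the $x_{i,0}$ and $y_{i,0}$, with its action of $G$. For $k\ge 0$ the quotient morphism $\tilde U\oplus U^{\oplus k}\to(\tilde U\oplus U^{\oplus k})/\!\!/G=\mathrm{Spec}\,\mathbb{C}[\tilde U\oplus U^{\oplus k}]^G$ induces a homomorphism $$\mathbb{C}\big[J_\infty\big((\tilde U\oplus U^{\oplus k})/\!\!/G\big)\big]\to\mathbb{C}\big[J_\infty(\tilde U\oplus U^{\oplus k})\big]^{J_\infty(G)}.\qquad(*)$$ (1) Suppose that $(*)$ is surjective for all $k\ge 0$. Then $(S^{\tilde U}\otimes L^U)^{J_\infty(G)}$ is the differential subalgebra (the smallest subalgebra closed under $D$) generated by $(S^{\tilde U}_0\otimes L^U_0)^G$. In particular, any set that generates $(S^{\tilde U}_0\otimes L^U_0)^G$ as an algebra generates $(S^{\tilde U}\otimes L^U)^{J_\infty(G)}$ as a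 differential algebra. (2) Suppose that $(*)$ is an isomorphism for all $k\ge 0$. Let $\{\alpha_t\}$ be a family of elements, each even or odd, that generates the algebra $(S^{\tilde U}_0\otimes L^U_0)^G$. Let $P_0$ be the polynomial superalgebra on generators $X_t$, where $X_t$ has the parity of $\alpha_t$, and let $P\supseteq P_0$ be the differential polynomial superalgebra on the $X_t$, i.e. the polynomial superalgebra on $X_t, DX_t, D^2X_t,\dots$. If a set $F\subseteq P_0$ generates the ideal of relations $\ker(P_0\to (S^{\tilde U}_0\otimes L^U_0)^G,\ X_t\mapsto\alpha_t)$, then the ideal of relations $\ker(P\to (S^{\tilde U}\otimes L^U)^{J_\infty(G)},\ D^jX_t\mapsto D^j\alpha_t)$ among the $\alpha_t$ and their derivatives is generated by $F$ as a differential ideal. (Ideals are two-sided.) -/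

import Mathlib

noncomputable section

open scoped TensorProduct

namespace ArcSuper

/-! ### Arc spaces of affine schemes -/

section Arc

variable (R : Type*) [CommRing R] [Algebra ℂ R]

/-- The relations saying that `r ↦ ∑ r⁽ʲ⁾ tʲ` is a homomorphism of `ℂ`-algebras, where the
variable `X (r, j)` stands for `r⁽ʲ⁾`. -/
def arcIdeal : Ideal (MvPolynomial (R × ℕ) ℂ) :=
  Ideal.span
    ({p | ∃ (r s : R) (j : ℕ),
        p = MvPolynomial.X (r + s, j) - (MvPolynomial.X (r, j) + MvPolynomial.X (s, j))} ∪
      {p | ∃ (r s : R) (j : ℕ),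
        p = MvPolynomial.X (r * s, j) -
          ∑ q ∈ Finset.HasAntidiagonal.antidiagonal j, MvPolynomial.X (r, q.1) * MvPolynomial.X (s, q.2)} ∪
      {p | ∃ (c : ℂ) (j : ℕ),
        p = MvPolynomial.X (algebraMap ℂ R c, j) - MvPolynomial.C (if j = 0 then c else 0)})

/-- The coordinate ring `ℂ[J_∞(X)]` of the arc space of the affine scheme `X = Spec R`. It
represents the functor `A ↦ Hom(R, A⟦t⟧)`: see `arcLift`, `arcLift_univ` and `arcAlg_hom_ext`. -/
def ArcAlg : Type _ := MvPolynomial (R × ℕ) ℂ ⧸ arcIdeal R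

instance : CommRing (ArcAlg R) := inferInstanceAs (CommRing (MvPolynomial (R × ℕ) ℂ ⧸ arcIdeal R))

instance : Algebra ℂ (ArcAlg R) :=
  inferInstanceAs (Algebra ℂ (MvPolynomial (R × ℕ) ℂ ⧸ arcIdeal R))

/-- The quotient map onto `ℂ[J_∞(X)]`. -/
def arcMk : MvPolynomial (R × ℕ) ℂ →ₐ[ℂ] ArcAlg R := Ideal.Quotient.mkₐ ℂ (arcIdeal R)

variable {R} in
theorem arcMk_eq_iff {p q : MvPolynomial (R × ℕ) ℂ} :
    arcMk R p = arcMk R q ↔ p - q ∈ arcIdeal R := Ideal.Quotient.eq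

variable {R}

/-- The function `r⁽ʲ⁾` on the arc space: the coefficient of `tʲ` in the function `r` along the
arc. -/
def arcCoeff (r : R) (j : ℕ) : ArcAlg R := arcMk R (MvPolynomial.X (r, j))

theorem arcCoeff_add (r s : R) (j : ℕ) :
    arcCoeff (r + s) j = arcCoeff r j + arcCoeff s j := by
  unfold arcCoeff
  rw [← map_add, arcMk_eq_iff]
  exact Ideal.subset_span (Or.inl (Or.inl ⟨r, s, j, rfl⟩))

theorem arcCoeff_mul (r s : R) (j : ℕ) :
    arcCoeff (r * s) j =
      ∑ q ∈ Finset.HasAntidiagonal.antidiagonal j, arcCoeff r q.1 * arcCoeff s q.2 := by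
  unfold arcCoeff
  simp only [← map_mul]
  rw [← map_sum, arcMk_eq_iff]
  exact Ideal.subset_span (Or.inl (Or.inr ⟨r, s, j, rfl⟩))

theorem arcCoeff_algebraMap (c : ℂ) (j : ℕ) :
    arcCoeff (algebraMap ℂ R c) j = algebraMap ℂ (ArcAlg R) (if j = 0 then c else 0) := by
  rw [← AlgHom.commutes (arcMk R)]
  unfold arcCoeff
  rw [arcMk_eq_iff]
  exact Ideal.subset_span (Or.inr ⟨c, j, rfl⟩)

variable (R) in
/-- The universal arc `r ↦ ∑ r⁽ʲ⁾ tʲ`. -/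
def arcUniv : R →ₐ[ℂ] PowerSeries (ArcAlg R) :=
  AlgHom.mk
    { toFun := fun r => PowerSeries.mk fun j => arcCoeff r j
      map_one' := by
        ext j
        have h := arcCoeff_algebraMap (R := R) 1 j
        rw [map_one] at h
        rw [PowerSeries.coeff_mk, PowerSeries.coeff_one, h]
        split_ifs <;> simp
      map_mul' := fun r s => by
        ext j
        simp [PowerSeries.coeff_mul, arcCoeff_mul]
      map_zero' := by
        ext j
        have h := arcCoeff_algebraMap (R := R) 0 j
        rw [map_zero] at h
        simp [h]
      map_add' := fun r s => by
        ext j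
        simp [arcCoeff_add] }
    (fun c => by
      ext j
      simp [arcCoeff_algebraMap, PowerSeries.algebraMap_apply, PowerSeries.coeff_C]
      split_ifs <;> simp)

@[simp]
theorem coeff_arcUniv (r : R) (j : ℕ) :
    PowerSeries.coeff j (arcUniv R r) = arcCoeff r j := by
  simp [arcUniv]

/-- The `A`-point of the arc space that corresponds to the arc `γ : Spec A⟦t⟧ → Spec R`. -/
def arcLift {A : Type*} [CommRing A] [Algebra ℂ A] (γ : R →ₐ[ℂ] PowerSeries A) :
    ArcAlg R →ₐ[ℂ] A :=
  Ideal.Quotient.liftₐ (arcIdeal R)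
    (MvPolynomial.aeval fun q : R × ℕ => PowerSeries.coeff q.2 (γ q.1))
    (by
      intro a ha
      have hle : arcIdeal R ≤ RingHom.ker
          (MvPolynomial.aeval (R := ℂ) fun q : R × ℕ => PowerSeries.coeff q.2 (γ q.1)) := by
        refine Ideal.span_le.2 ?_
        rintro p ((⟨r, s, j, rfl⟩ | ⟨r, s, j, rfl⟩) | ⟨c, j, rfl⟩)
        · simp [RingHom.mem_ker]
        · simp [RingHom.mem_ker, PowerSeries.coeff_mul]
        · simp [RingHom.mem_ker, PowerSeries.algebraMap_apply, PowerSeries.coeff_C]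
          split_ifs <;> simp
      exact hle ha)

@[simp]
theorem arcLift_arcCoeff {A : Type*} [CommRing A] [Algebra ℂ A] (γ : R →ₐ[ℂ] PowerSeries A)
    (r : R) (j : ℕ) : arcLift γ (arcCoeff r j) = PowerSeries.coeff j (γ r) := by
  exact (Ideal.Quotient.lift_mk _ _ _).trans (MvPolynomial.aeval_X _ _)

theorem arcLift_univ {A : Type*} [CommRing A] [Algebra ℂ A] (γ : R →ₐ[ℂ] PowerSeries A) :
    (PowerSeries.mapAlgHom (arcLift γ)).comp (arcUniv R) = γ := by
  ext r j
  simp [PowerSeries.mapAlgHom_apply]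

theorem arcAlg_hom_ext {A : Type*} [CommRing A] [Algebra ℂ A] {f g : ArcAlg R →ₐ[ℂ] A}
    (h : ∀ r j, f (arcCoeff r j) = g (arcCoeff r j)) : f = g := by
  have hfg : f.comp (arcMk R) = g.comp (arcMk R) := MvPolynomial.algHom_ext fun q => h q.1 q.2
  ext x
  obtain ⟨p, rfl⟩ : ∃ p, arcMk R p = x := Ideal.Quotient.mk_surjective x
  exact DFunLike.congr_fun hfg p

/-- The comorphism of `J_∞(Spec S) → J_∞(Spec R)` induced by a morphism `Spec S → Spec R`. -/
def arcMap {S : Type*} [CommRing S] [Algebra ℂ S] (f : R →ₐ[ℂ] S) : ArcAlg R →ₐ[ℂ] ArcAlg S :=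
  arcLift ((arcUniv S).comp f)

/-- If the affine group scheme `Spec H` acts on `Spec R` with comorphism `c`, this is the
comorphism of the induced action of `J_∞(Spec H)` on `J_∞(Spec R)`. On arcs it sends a pair
consisting of an arc of the group and an arc of `Spec R` to their pointwise product. -/
def arcCoaction {H : Type*} [CommRing H] [Algebra ℂ H] (c : R →ₐ[ℂ] H ⊗[ℂ] R) :
    ArcAlg R →ₐ[ℂ] ArcAlg H ⊗[ℂ] ArcAlg R :=
  arcLift
    ((Algebra.TensorProduct.productMap
      ((PowerSeries.mapAlgHom
        (Algebra.TensorProduct.includeLeft : ArcAlg H →ₐ[ℂ] ArcAlg H ⊗[ℂ] ArcAlg R)).comp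
          (arcUniv H))
      ((PowerSeries.mapAlgHom
        (Algebra.TensorProduct.includeRight : ArcAlg R →ₐ[ℂ] ArcAlg H ⊗[ℂ] ArcAlg R)).comp
          (arcUniv R))).comp c)

end Arc

/-- The elements invariant under a coaction: those `b` with `c b = 1 ⊗ b`. -/
def coinvariants {O B : Type*} [CommRing O] [Algebra ℂ O] [Ring B] [Algebra ℂ B]
    (c : B →ₐ[ℂ] O ⊗[ℂ] B) : Subalgebra ℂ B :=
  AlgHom.equalizer c Algebra.TensorProduct.includeRight

section Quotient

variable {R : Type*} [CommRing R] [Algebra ℂ R] {H : Type*} [CommRing H] [Algebra ℂ H]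

theorem arcMap_val_mem (c : R →ₐ[ℂ] H ⊗[ℂ] R) (f : ArcAlg (coinvariants c)) :
    arcMap (coinvariants c).val f ∈ coinvariants (arcCoaction c) := by
  suffices h : (arcCoaction c).comp (arcMap (coinvariants c).val) =
      (Algebra.TensorProduct.includeRight : ArcAlg R →ₐ[ℂ] ArcAlg H ⊗[ℂ] ArcAlg R).comp
        (arcMap (coinvariants c).val) from DFunLike.congr_fun h f
  refine arcAlg_hom_ext fun r j => ?_
  have hr : c (r : R) = 1 ⊗ₜ (r : R) := r.2
  simp [arcMap, arcCoaction, hr, PowerSeries.mapAlgHom_apply]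

/-- For `X = Spec R` with an action of `G = Spec H`, the homomorphism
`ℂ[J_∞(X // G)] → ℂ[J_∞(X)]^{J_∞(G)}` induced by the quotient morphism `X → X // G`, where
`X // G = Spec (R^G)`. -/
def arcQuotientMap (c : R →ₐ[ℂ] H ⊗[ℂ] R) :
    ArcAlg (coinvariants c) →ₐ[ℂ] coinvariants (arcCoaction c) :=
  (arcMap (coinvariants c).val).codRestrict (coinvariants (arcCoaction c)) (arcMap_val_mem c)

end Quotient

/-! ### Modules of an affine algebraic group -/

/-- The structure of a `G`-module on `V`, for the affine group scheme `G = Spec H`: a coaction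
`V → V ⊗ H`, coassociative and counital. -/
structure GModule (H V : Type*) [CommRing H] [HopfAlgebra ℂ H] [AddCommGroup V] [Module ℂ V] where
  /-- The coaction. -/
  coact : V →ₗ[ℂ] V ⊗[ℂ] H
  coassoc : (TensorProduct.assoc ℂ V H H).toLinearMap ∘ₗ coact.rTensor H ∘ₗ coact =
    (Coalgebra.comul (R := ℂ) (A := H)).lTensor V ∘ₗ coact
  counit : (TensorProduct.rid ℂ V).toLinearMap ∘ₗ
    (Coalgebra.counit (R := ℂ) (A := H)).lTensor V ∘ₗ coact = LinearMap.id

/-- The matrix coefficients `a i k ∈ ℂ[G]` of a `G`-module with respect to a basis `b`; that is,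
`g • b k = ∑ i, a i k (g) • b i`. -/
def GModule.mat {H V : Type*} [CommRing H] [HopfAlgebra ℂ H] [AddCommGroup V] [Module ℂ V]
    (ρ : GModule H V) {ι : Type*} (b : Module.Basis ι ℂ V) : Matrix ι ι H :=
  fun i k => TensorProduct.lid ℂ H ((b.coord i).rTensor H (ρ.coact (b k)))

/-- The matrix of the direct sum of one module with matrix `a` and `k` copies of a module with
matrix `b`. -/
def sumMat {H ι κ : Type*} [CommRing H] (a : Matrix ι ι H) (b : Matrix κ κ H) (k : ℕ) :
    Matrix (ι ⊕ Fin k × κ) (ι ⊕ Fin k × κ) H :=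
  Matrix.fromBlocks a 0 0 (Matrix.of fun p q => if p.1 = q.1 then b p.2 q.2 else 0)

/-- The action of `G` on the coordinate ring `ℂ[V]`, the polynomial ring in the coordinate
functions of a module `V` with matrix `a`; that is, `x_i(g • v) = ∑ k, a i k (g) x_k(v)`. -/
def polyCoaction {H σ : Type*} [CommRing H] [Algebra ℂ H] [Fintype σ] (a : Matrix σ σ H) :
    MvPolynomial σ ℂ →ₐ[ℂ] H ⊗[ℂ] MvPolynomial σ ℂ :=
  MvPolynomial.aeval fun i => ∑ k, a i k ⊗ₜ[ℂ] MvPolynomial.X k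

/-! ### Polynomial superalgebras -/

/-- The polynomial superalgebra `ℂ[x_s] ⊗ Λ[y_n]` on even generators indexed by `σ` and odd
generators indexed by `ν`. -/
def SuperPoly (σ ν : Type*) : Type _ := MvPolynomial σ ℂ ⊗[ℂ] ExteriorAlgebra ℂ (ν →₀ ℂ)

instance (σ ν : Type*) : Ring (SuperPoly σ ν) :=
  inferInstanceAs (Ring (MvPolynomial σ ℂ ⊗[ℂ] ExteriorAlgebra ℂ (ν →₀ ℂ)))

instance (σ ν : Type*) : Algebra ℂ (SuperPoly σ ν) :=
  inferInstanceAs (Algebra ℂ (MvPolynomial σ ℂ ⊗[ℂ] ExteriorAlgebra ℂ (ν →₀ ℂ)))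

/-- The identification of `SuperPoly σ ν` with the tensor product that defines it. -/
def superEquiv (σ ν : Type*) :
    MvPolynomial σ ℂ ⊗[ℂ] ExteriorAlgebra ℂ (ν →₀ ℂ) ≃ₐ[ℂ] SuperPoly σ ν := AlgEquiv.refl

section Super

variable {σ ν : Type*}

variable (ν) in
/-- The inclusion of the polynomial ring. -/
def evenIncl : MvPolynomial σ ℂ →ₐ[ℂ] SuperPoly σ ν :=
  (superEquiv σ ν).toAlgHom.comp Algebra.TensorProduct.includeLeft

variable (σ) in
/-- The inclusion of the exterior algebra. -/
def oddIncl : ExteriorAlgebra ℂ (ν →₀ ℂ) →ₐ[ℂ] SuperPoly σ ν :=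
  (superEquiv σ ν).toAlgHom.comp Algebra.TensorProduct.includeRight

variable (ν) in
/-- The even generators. -/
def evenGen (s : σ) : SuperPoly σ ν := evenIncl ν (MvPolynomial.X s)

variable (σ) in
/-- Linear combinations of odd generators. -/
def oddLin : (ν →₀ ℂ) →ₗ[ℂ] SuperPoly σ ν := (oddIncl σ).toLinearMap ∘ₗ ExteriorAlgebra.ι ℂ

variable (σ) in
/-- The odd generators. -/
def oddGen (n : ν) : SuperPoly σ ν := oddLin σ (Finsupp.single n 1)

@[elab_as_elim]
theorem superPoly_induction {C : SuperPoly σ ν → Prop}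
    (hc : ∀ c : ℂ, C (algebraMap ℂ _ c)) (heven : ∀ s, C (evenGen ν s))
    (hodd : ∀ m, C (oddLin σ m)) (hmul : ∀ a b, C a → C b → C (a * b))
    (hadd : ∀ a b, C a → C b → C (a + b)) (b : SuperPoly σ ν) : C b := by
  have h1 : ∀ s, C (evenIncl ν s) := by
    intro s
    induction s using MvPolynomial.induction_on with
    | C c =>
      have := hc c
      rwa [← AlgHom.commutes (evenIncl ν)] at this
    | add p q hp hq => rw [map_add]; exact hadd _ _ hp hq
    | mul_X p i hp => rw [map_mul]; exact hmul _ _ hp (heven i)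
  have h2 : ∀ a, C (oddIncl σ a) := by
    intro a
    induction a using ExteriorAlgebra.induction with
    | algebraMap r => rw [AlgHom.commutes]; exact hc r
    | ι x => exact hodd x
    | mul a b ha hb => rw [map_mul]; exact hmul _ _ ha hb
    | add a b ha hb => rw [map_add]; exact hadd _ _ ha hb
  have h3 : ∀ z, C (superEquiv σ ν z) := by
    intro z
    induction z using TensorProduct.induction_on with
    | zero => rw [map_zero, ← map_zero (algebraMap ℂ _)]; exact hc 0
    | tmul s a =>
      have h : superEquiv σ ν (s ⊗ₜ a) = evenIncl ν s * oddIncl σ a := by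
        simp [evenIncl, oddIncl, ← map_mul]
      rw [h]
      exact hmul _ _ (h1 s) (h2 a)
    | add x y hx hy => rw [map_add]; exact hadd _ _ hx hy
  simpa using h3 ((superEquiv σ ν).symm b)

/-- The homomorphism from a polynomial superalgebra that sends the even generators to the central
elements `a s` and the odd generators to the elements `b n`, whose linear combinations square to
zero. -/
def superLift {A : Type*} [Ring A] [Algebra ℂ A] (a : σ → A)
    (ha : ∀ s, a s ∈ Subalgebra.center ℂ A) (b : ν → A)
    (hb : ∀ m : ν →₀ ℂ,
      Finsupp.linearCombination ℂ b m * Finsupp.linearCombination ℂ b m = 0) :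
    SuperPoly σ ν →ₐ[ℂ] A :=
  (Algebra.TensorProduct.lift
    ((Subalgebra.center ℂ A).val.comp
      (MvPolynomial.aeval fun s => (⟨a s, ha s⟩ : Subalgebra.center ℂ A)))
    (ExteriorAlgebra.lift ℂ ⟨Finsupp.linearCombination ℂ b, hb⟩)
    (fun x y => by
      have h := (MvPolynomial.aeval (fun s => (⟨a s, ha s⟩ : Subalgebra.center ℂ A)) x).2
      exact ((Subalgebra.mem_center_iff.1 h) _).symm)).comp (superEquiv σ ν).symm.toAlgHom

section Lift

variable {A : Type*} [Ring A] [Algebra ℂ A] (a : σ → A)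
  (ha : ∀ s, a s ∈ Subalgebra.center ℂ A) (b : ν → A)
  (hb : ∀ m : ν →₀ ℂ, Finsupp.linearCombination ℂ b m * Finsupp.linearCombination ℂ b m = 0)

@[simp]
theorem superLift_evenGen (s : σ) : superLift a ha b hb (evenGen ν s) = a s := by
  have h := Algebra.TensorProduct.lift_tmul ((Subalgebra.center ℂ A).val.comp
      (MvPolynomial.aeval fun s => (⟨a s, ha s⟩ : Subalgebra.center ℂ A)))
    (ExteriorAlgebra.lift ℂ ⟨Finsupp.linearCombination ℂ b, hb⟩)
    (fun x y => by
      have h := (MvPolynomial.aeval (fun s => (⟨a s, ha s⟩ : Subalgebra.center ℂ A)) x).2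
      exact ((Subalgebra.mem_center_iff.1 h) _).symm) (MvPolynomial.X s) 1
  refine Eq.trans h ?_
  simp

@[simp]
theorem superLift_oddLin (m : ν →₀ ℂ) :
    superLift a ha b hb (oddLin σ m) = Finsupp.linearCombination ℂ b m := by
  have h := Algebra.TensorProduct.lift_tmul ((Subalgebra.center ℂ A).val.comp
      (MvPolynomial.aeval fun s => (⟨a s, ha s⟩ : Subalgebra.center ℂ A)))
    (ExteriorAlgebra.lift ℂ ⟨Finsupp.linearCombination ℂ b, hb⟩)
    (fun x y => by
      have h := (MvPolynomial.aeval (fun s => (⟨a s, ha s⟩ : Subalgebra.center ℂ A)) x).2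
      exact ((Subalgebra.mem_center_iff.1 h) _).symm) 1 (ExteriorAlgebra.ι ℂ m)
  refine Eq.trans h ?_
  simp

@[simp]
theorem superLift_oddGen (n : ν) : superLift a ha b hb (oddGen σ n) = b n := by
  simp [oddGen]

end Lift

theorem oddLin_swap (m n : ν →₀ ℂ) : oddLin σ m * oddLin σ n = -(oddLin σ n * oddLin σ m) := by
  refine eq_neg_of_add_eq_zero_left ?_
  have h := congrArg (oddIncl σ) (ExteriorAlgebra.ι_add_mul_swap (R := ℂ) m n)
  rw [map_add, map_mul, map_mul, map_zero] at h
  exact h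

theorem oddLin_linearCombination (m : ν →₀ ℂ) :
    Finsupp.linearCombination ℂ (fun n => -oddGen σ n) m = -oddLin σ m := by
  have h : Finsupp.linearCombination ℂ (fun n : ν => -oddGen σ n) = -oddLin σ := by
    refine Finsupp.lhom_ext' fun n => LinearMap.ext_ring ?_
    simp [oddGen]
  rw [h, LinearMap.neg_apply]

theorem oddLin_mul_self (m : ν →₀ ℂ) : oddLin σ m * oddLin σ m = 0 := by
  have h := congrArg (oddIncl σ) (ExteriorAlgebra.ι_sq_zero (R := ℂ) m)
  rw [map_mul, map_zero] at h
  exact h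

theorem evenGen_mem_center (s : σ) :
    evenGen ν s ∈ Subalgebra.center ℂ (SuperPoly σ ν) := by
  rw [Subalgebra.mem_center_iff]
  intro b
  obtain ⟨z, rfl⟩ := (superEquiv σ ν).surjective b
  have h : evenGen ν s = superEquiv σ ν (MvPolynomial.X s ⊗ₜ 1) := rfl
  rw [h, ← map_mul, ← map_mul]
  congr 1
  induction z using TensorProduct.induction_on with
  | zero => simp
  | tmul p a => simp [mul_comm]
  | add x y hx hy => rw [add_mul, hx, hy, mul_add]

/-- The parity automorphism: `1` on even elements and `-1` on odd elements. -/
def parity (σ ν : Type*) : SuperPoly σ ν →ₐ[ℂ] SuperPoly σ ν :=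
  superLift (evenGen ν) evenGen_mem_center (fun n => -oddGen σ n)
    (fun m => by rw [oddLin_linearCombination, neg_mul_neg, oddLin_mul_self])

/-- Even elements of the superalgebra. -/
def IsEvenElt (b : SuperPoly σ ν) : Prop := parity σ ν b = b

/-- Odd elements of the superalgebra. -/
def IsOddElt (b : SuperPoly σ ν) : Prop := parity σ ν b = -b

theorem isEvenElt_evenGen (s : σ) : IsEvenElt (evenGen ν s) := by
  simp [IsEvenElt, parity]

theorem isOddElt_oddLin (m : ν →₀ ℂ) : IsOddElt (oddLin σ m) := by
  rw [IsOddElt, parity, superLift_oddLin, oddLin_linearCombination]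

theorem oddLin_mul (m : ν →₀ ℂ) (b : SuperPoly σ ν) :
    oddLin σ m * b = parity σ ν b * oddLin σ m := by
  induction b using superPoly_induction with
  | hc c => rw [AlgHom.commutes]; exact (Algebra.commutes c _).symm
  | heven s =>
    rw [isEvenElt_evenGen s]
    exact (Subalgebra.mem_center_iff.1 (evenGen_mem_center s)) _
  | hodd n => rw [isOddElt_oddLin, neg_mul, oddLin_swap]
  | hmul a b ha hb => rw [← mul_assoc, ha, mul_assoc, hb, map_mul, mul_assoc]
  | hadd a b ha hb => rw [mul_add, ha, hb, map_add, add_mul]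

/-- Even elements are central. -/
theorem IsEvenElt.mem_center {x : SuperPoly σ ν} (hx : IsEvenElt x) :
    x ∈ Subalgebra.center ℂ (SuperPoly σ ν) := by
  rw [Subalgebra.mem_center_iff]
  intro b
  induction b using superPoly_induction with
  | hc c => exact Algebra.commutes c x
  | heven s => exact ((Subalgebra.mem_center_iff.1 (evenGen_mem_center s)) x).symm
  | hodd m => rw [oddLin_mul, hx]
  | hmul a b ha hb => rw [mul_assoc, hb, ← mul_assoc, ha, mul_assoc]
  | hadd a b ha hb => rw [add_mul, ha, hb, mul_add]

theorem IsOddElt.mul_eq {x : SuperPoly σ ν} (hx : IsOddElt x) (b : SuperPoly σ ν) :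
    x * b = parity σ ν b * x := by
  induction b using superPoly_induction with
  | hc c => rw [AlgHom.commutes]; exact (Algebra.commutes c x).symm
  | heven s =>
    rw [isEvenElt_evenGen s]
    exact (Subalgebra.mem_center_iff.1 (evenGen_mem_center s)) x
  | hodd m =>
    have h := oddLin_mul m x
    rw [hx, neg_mul] at h
    rw [isOddElt_oddLin m, neg_mul, h, neg_neg]
  | hmul a b ha hb => rw [← mul_assoc, ha, mul_assoc, hb, map_mul, mul_assoc]
  | hadd a b ha hb => rw [mul_add, ha, hb, map_add, add_mul]

theorem mul_self_eq_zero_of_neg {A : Type*} [Ring A] [Algebra ℂ A] {x : A}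
    (h : x * x = -(x * x)) : x * x = 0 := by
  have h2 : (2 : ℂ) • (x * x) = 0 := by
    rw [two_smul]
    nth_rewrite 1 [h]
    exact neg_add_cancel _
  exact (smul_eq_zero.1 h2).resolve_left two_ne_zero

theorem IsOddElt.mul_self {x : SuperPoly σ ν} (hx : IsOddElt x) : x * x = 0 := by
  have h := hx.mul_eq x
  rw [hx, neg_mul] at h
  exact mul_self_eq_zero_of_neg h

theorem IsOddElt.linearCombination {τ : Type*} {b : τ → SuperPoly σ ν}
    (hb : ∀ t, IsOddElt (b t)) (m : τ →₀ ℂ) : IsOddElt (Finsupp.linearCombination ℂ b m) := by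
  unfold IsOddElt at *
  simp only [Finsupp.linearCombination_apply, Finsupp.sum, map_sum, map_smul, hb, smul_neg,
    Finset.sum_neg_distrib]

/-- Evaluation of superpolynomials in the generators `X_t`, even for `t ∈ τ₀` and odd for
`t ∈ τ₁`, at elements of the same parity of a polynomial superalgebra. -/
def superEval {τ₀ τ₁ : Type*} (a : τ₀ → SuperPoly σ ν) (ha : ∀ t, IsEvenElt (a t))
    (b : τ₁ → SuperPoly σ ν) (hb : ∀ t, IsOddElt (b t)) : SuperPoly τ₀ τ₁ →ₐ[ℂ] SuperPoly σ ν :=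
  superLift a (fun t => (ha t).mem_center) b
    (fun m => (IsOddElt.linearCombination hb m).mul_self)

end Super

/-! ### Coactions on polynomial superalgebras -/

section SuperCoaction

variable {O σ ν : Type*} [CommRing O] [Algebra ℂ O]

theorem tmul_mem_center {x : SuperPoly σ ν} (hx : x ∈ Subalgebra.center ℂ (SuperPoly σ ν))
    (o : O) : o ⊗ₜ[ℂ] x ∈ Subalgebra.center ℂ (O ⊗[ℂ] SuperPoly σ ν) := by
  rw [Subalgebra.mem_center_iff] at hx ⊢
  intro z
  induction z using TensorProduct.induction_on with
  | zero => simp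
  | tmul p a => simp [hx, mul_comm]
  | add z w hz hw => rw [add_mul, hz, hw, mul_add]

theorem lTensor_oddLin_mul (z w : O ⊗[ℂ] (ν →₀ ℂ)) :
    (oddLin σ).lTensor O z * (oddLin σ).lTensor O w =
      -((oddLin σ).lTensor O w * (oddLin σ).lTensor O z) := by
  induction z using TensorProduct.induction_on with
  | zero => rw [map_zero, zero_mul, mul_zero, neg_zero]
  | tmul p m =>
    induction w using TensorProduct.induction_on with
    | zero => rw [map_zero, zero_mul, mul_zero, neg_zero]
    | tmul q n =>
      rw [LinearMap.lTensor_tmul, LinearMap.lTensor_tmul, Algebra.TensorProduct.tmul_mul_tmul,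
        Algebra.TensorProduct.tmul_mul_tmul, oddLin_swap, TensorProduct.tmul_neg, mul_comm p q]
    | add w v hw hv => rw [map_add, mul_add, add_mul, hw, hv, neg_add]
  | add z v hz hv => rw [map_add, mul_add, add_mul, hz, hv, neg_add]

theorem lTensor_oddLin_mul_self (z : O ⊗[ℂ] (ν →₀ ℂ)) :
    (oddLin σ).lTensor O z * (oddLin σ).lTensor O z = 0 :=
  mul_self_eq_zero_of_neg (lTensor_oddLin_mul z z)

/-- The coaction on a polynomial superalgebra with `x_s ↦ ∑ s', c₀ s s' ⊗ x_{s'}` and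
`y_n ↦ ∑ n', c₁ n n' ⊗ y_{n'}`; the rows of `c₀` and `c₁` are finitely supported. -/
def superCoaction (c₀ : σ → σ →₀ O) (c₁ : ν → ν →₀ O) :
    SuperPoly σ ν →ₐ[ℂ] O ⊗[ℂ] SuperPoly σ ν :=
  superLift
    (fun s => (c₀ s).sum fun s' o => o ⊗ₜ[ℂ] evenGen ν s')
    (fun _ => Subalgebra.sum_mem _ fun _ _ => tmul_mem_center (evenGen_mem_center _) _)
    (fun n => (c₁ n).sum fun n' o => o ⊗ₜ[ℂ] oddGen σ n')
    (fun m => by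
      have h : Finsupp.linearCombination ℂ
          (fun n => (c₁ n).sum fun n' o => o ⊗ₜ[ℂ] oddGen σ n') m =
          (oddLin σ).lTensor O (Finsupp.linearCombination ℂ
            (fun n => (c₁ n).sum fun n' o => o ⊗ₜ[ℂ] Finsupp.single n' (1 : ℂ)) m) := by
        simp only [Finsupp.linearCombination_apply, Finsupp.sum, map_sum, map_smul,
          LinearMap.lTensor_tmul, oddGen]
      rw [h]
      exact lTensor_oddLin_mul_self _)

variable {ι κ H : Type*} [Fintype ι] [Fintype κ] [CommRing H] [Algebra ℂ H]

/-- The `i`-th row of the matrix of `G` on the span of the coordinate functions `x_i`. -/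
def classicalRow (a : Matrix ι ι H) (i : ι) : ι →₀ H := ∑ k, Finsupp.single k (a i k)

/-- The action of `G` on `ℂ[Ũ] ⊗ Λ(U*)`, for modules `Ũ`, `U` with matrices `a`, `b`: the
generator `x_i` is sent to `∑ k, a_{ik} ⊗ x_k` and `y_i` to `∑ k, b_{ik} ⊗ y_k`. -/
def classicalCoaction (a : Matrix ι ι H) (b : Matrix κ κ H) :
    SuperPoly ι κ →ₐ[ℂ] H ⊗[ℂ] SuperPoly ι κ :=
  superCoaction (classicalRow a) (classicalRow b)

/-- The `(i, j)`-th row of the matrix of `J_∞(G)` on the span of the variables `x_{i,j}`: as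
`∑ j, x_{i,j} tʲ` is sent to `∑ k, a_{ik}(t) ∑ j, x_{k,j} tʲ`, the variable `x_{i,j}` is sent to
`∑ p + q = j, ∑ k, a_{ik}⁽ᵖ⁾ x_{k,q}`. -/
def arcRow (a : Matrix ι ι H) (s : ι × ℕ) : ι × ℕ →₀ ArcAlg H :=
  ∑ q ∈ Finset.HasAntidiagonal.antidiagonal s.2, ∑ k, Finsupp.single (k, q.2) (arcCoeff (a s.1 k) q.1)

/-- The action of `J_∞(G)` on `S^Ũ ⊗ L^U`, the polynomial superalgebra on the even generators
`x_{i,j}` and the odd generators `y_{i,j}`, `j ≥ 0`. -/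
def arcSuperCoaction (a : Matrix ι ι H) (b : Matrix κ κ H) :
    SuperPoly (ι × ℕ) (κ × ℕ) →ₐ[ℂ] ArcAlg H ⊗[ℂ] SuperPoly (ι × ℕ) (κ × ℕ) :=
  superCoaction (arcRow a) (arcRow b)

end SuperCoaction

/-! ### The differential -/

section Differential

variable {M : Type*} [AddCommGroup M] [Module ℂ M]

/-- The homomorphism `m ↦ m + ε δ(m)` to the dual numbers over the exterior algebra. -/
def exteriorDual (δ : M →ₗ[ℂ] M) : ExteriorAlgebra ℂ M →ₐ[ℂ] DualNumber (ExteriorAlgebra ℂ M) :=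
  ExteriorAlgebra.lift ℂ
    ⟨{  toFun := fun m =>
          TrivSqZeroExt.inl (ExteriorAlgebra.ι ℂ m) + TrivSqZeroExt.inr (ExteriorAlgebra.ι ℂ (δ m))
        map_add' := fun m n => by ext <;> simp
        map_smul' := fun c m => by ext <;> simp },
      fun m => by
        ext
        · simp
        · simp⟩

/-- The even derivation of the exterior algebra that extends a linear endomorphism `δ` of the space
of generators: the coefficient of `ε` in the homomorphism `m ↦ m + ε δ(m)`. -/
def exteriorDer (δ : M →ₗ[ℂ] M) : ExteriorAlgebra ℂ M →ₗ[ℂ] ExteriorAlgebra ℂ M where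
  toFun a := (exteriorDual δ a).snd
  map_add' a b := by simp
  map_smul' c a := by simp

theorem exteriorDual_fst (δ : M →ₗ[ℂ] M) (a : ExteriorAlgebra ℂ M) :
    (exteriorDual δ a).fst = a := by
  have h : (TrivSqZeroExt.fstHom ℂ (ExteriorAlgebra ℂ M) (ExteriorAlgebra ℂ M)).comp
      (exteriorDual δ) = AlgHom.id ℂ _ := by
    ext m
    simp [exteriorDual]
  exact DFunLike.congr_fun h a

theorem exteriorDer_ι (δ : M →ₗ[ℂ] M) (m : M) :
    exteriorDer δ (ExteriorAlgebra.ι ℂ m) = ExteriorAlgebra.ι ℂ (δ m) := by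
  simp [exteriorDer, exteriorDual]

theorem exteriorDer_mul (δ : M →ₗ[ℂ] M) (a b : ExteriorAlgebra ℂ M) :
    exteriorDer δ (a * b) = a * exteriorDer δ b + exteriorDer δ a * b := by
  simp [exteriorDer, exteriorDual_fst]

theorem exteriorDer_algebraMap (δ : M →ₗ[ℂ] M) (c : ℂ) :
    exteriorDer δ (algebraMap ℂ _ c) = 0 := by
  change (exteriorDual δ (algebraMap ℂ _ c)).snd = 0
  rw [AlgHom.commutes]
  rfl

variable (σ ν : Type*)

/-- The differential of the polynomial ring on variables `x_{s,j}`, `D x_{s,j} = (j+1) x_{s,j+1}`. -/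
def polyD : Derivation ℂ (MvPolynomial (σ × ℕ) ℂ) (MvPolynomial (σ × ℕ) ℂ) :=
  MvPolynomial.mkDerivation ℂ fun q => ((q.2 + 1 : ℕ) : ℂ) • MvPolynomial.X (q.1, q.2 + 1)

/-- The linear map `y_{n,j} ↦ (j+1) y_{n,j+1}`. -/
def shiftD : (ν × ℕ →₀ ℂ) →ₗ[ℂ] (ν × ℕ →₀ ℂ) :=
  Finsupp.linearCombination ℂ fun q => Finsupp.single (q.1, q.2 + 1) ((q.2 + 1 : ℕ) : ℂ)

/-- The even differential `D` of the polynomial superalgebra on even generators `x_{s,j}` and odd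
generators `y_{n,j}`, with `D x_{s,j} = (j+1) x_{s,j+1}` and `D y_{n,j} = (j+1) y_{n,j+1}`. -/
def superD : SuperPoly (σ × ℕ) (ν × ℕ) →ₗ[ℂ] SuperPoly (σ × ℕ) (ν × ℕ) :=
  (superEquiv _ _).toLinearMap ∘ₗ
    ((polyD σ).toLinearMap.rTensor (ExteriorAlgebra ℂ (ν × ℕ →₀ ℂ)) +
      (exteriorDer (shiftD ν)).lTensor (MvPolynomial (σ × ℕ) ℂ)) ∘ₗ
    (superEquiv _ _).symm.toLinearMap

variable {σ ν}

theorem superD_mul (a b : SuperPoly (σ × ℕ) (ν × ℕ)) :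
    superD σ ν (a * b) = a * superD σ ν b + superD σ ν a * b := by
  obtain ⟨z, rfl⟩ := (superEquiv _ _).surjective a
  obtain ⟨w, rfl⟩ := (superEquiv _ _).surjective b
  induction z using TensorProduct.induction_on with
  | zero => simp
  | tmul p x =>
    induction w using TensorProduct.induction_on with
    | zero => simp
    | tmul q y =>
      rw [← map_mul]
      simp only [superD, LinearMap.comp_apply, AlgEquiv.toLinearMap_apply,
        AlgEquiv.symm_apply_apply, ← map_mul, ← map_add]
      congr 1
      simp only [LinearMap.add_apply, Algebra.TensorProduct.tmul_mul_tmul, LinearMap.rTensor_tmul,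
        LinearMap.lTensor_tmul, Derivation.coeFn_coe, Derivation.leibniz, exteriorDer_mul,
        smul_eq_mul, TensorProduct.add_tmul, TensorProduct.tmul_add, mul_add, add_mul,
        mul_comm q (polyD σ p)]
      abel
    | add u v hu hv => rw [map_add, mul_add, map_add, hu, hv, map_add, mul_add, mul_add]; abel
  | add u v hu hv => rw [map_add, add_mul, map_add, hu, hv, map_add, add_mul, add_mul]; abel

theorem superD_algebraMap (c : ℂ) : superD σ ν (algebraMap ℂ _ c) = 0 := by
  have h := superD_mul (σ := σ) (ν := ν) 1 1
  rw [mul_one, mul_one, one_mul] at h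
  rw [Algebra.algebraMap_eq_smul_one, map_smul, left_eq_add.1 h, smul_zero]

theorem superD_evenGen (s : σ) (j : ℕ) :
    superD σ ν (evenGen (ν × ℕ) (s, j)) = ((j + 1 : ℕ) : ℂ) • evenGen (ν × ℕ) (s, j + 1) := by
  have h : evenGen (ν × ℕ) (s, j) = superEquiv _ _ (MvPolynomial.X (s, j) ⊗ₜ 1) := rfl
  have h' : evenGen (ν × ℕ) (s, j + 1) = superEquiv _ _ (MvPolynomial.X (s, j + 1) ⊗ₜ 1) := rfl
  have h1 : exteriorDer (shiftD ν) 1 = 0 := by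
    simpa using exteriorDer_algebraMap (shiftD ν) 1
  rw [h, h', ← map_smul]
  simp only [superD, LinearMap.comp_apply, AlgEquiv.toLinearMap_apply, AlgEquiv.symm_apply_apply]
  congr 1
  simp only [LinearMap.add_apply, LinearMap.rTensor_tmul, LinearMap.lTensor_tmul,
    Derivation.coeFn_coe, polyD, MvPolynomial.mkDerivation_X, h1, TensorProduct.tmul_zero, add_zero,
    TensorProduct.smul_tmul']

theorem superD_oddLin (m : ν × ℕ →₀ ℂ) :
    superD σ ν (oddLin (σ × ℕ) m) = oddLin (σ × ℕ) (shiftD ν m) := by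
  have h : ∀ n : ν × ℕ →₀ ℂ,
      oddLin (σ × ℕ) n = superEquiv _ _ (1 ⊗ₜ ExteriorAlgebra.ι ℂ n) := fun _ => rfl
  rw [h, h]
  simp only [superD, LinearMap.comp_apply, AlgEquiv.toLinearMap_apply, AlgEquiv.symm_apply_apply]
  congr 1
  simp only [LinearMap.add_apply, LinearMap.rTensor_tmul, LinearMap.lTensor_tmul,
    Derivation.coeFn_coe, Derivation.map_one_eq_zero, exteriorDer_ι, TensorProduct.zero_tmul,
    zero_add]

theorem parity_superD (b : SuperPoly (σ × ℕ) (ν × ℕ)) :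
    parity _ _ (superD σ ν b) = superD σ ν (parity _ _ b) := by
  induction b using superPoly_induction with
  | hc c => rw [superD_algebraMap, AlgHom.commutes, superD_algebraMap, map_zero]
  | heven s =>
    rw [superD_evenGen, map_smul, isEvenElt_evenGen, isEvenElt_evenGen, superD_evenGen]
  | hodd m => rw [superD_oddLin, isOddElt_oddLin, isOddElt_oddLin, map_neg, superD_oddLin]
  | hmul a b ha hb => rw [superD_mul, map_mul, superD_mul, map_add, map_mul, map_mul, ha, hb]
  | hadd a b ha hb => rw [map_add, map_add, map_add, map_add, ha, hb]

theorem IsEvenElt.iterate_superD {b : SuperPoly (σ × ℕ) (ν × ℕ)} (hb : IsEvenElt b) (j : ℕ) :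
    IsEvenElt ((superD σ ν)^[j] b) := by
  induction j with
  | zero => exact hb
  | succ j ih =>
    rw [Function.iterate_succ_apply', IsEvenElt, parity_superD, ih]

theorem IsOddElt.iterate_superD {b : SuperPoly (σ × ℕ) (ν × ℕ)} (hb : IsOddElt b) (j : ℕ) :
    IsOddElt ((superD σ ν)^[j] b) := by
  induction j with
  | zero => exact hb
  | succ j ih =>
    rw [Function.iterate_succ_apply', IsOddElt, parity_superD, ih, map_neg]

theorem IsEvenElt.smul {b : SuperPoly σ ν} (hb : IsEvenElt b) (c : ℂ) : IsEvenElt (c • b) := by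
  rw [IsEvenElt, map_smul, hb]

theorem IsOddElt.smul {b : SuperPoly σ ν} (hb : IsOddElt b) (c : ℂ) : IsOddElt (c • b) := by
  rw [IsOddElt, map_smul, hb, smul_neg]

variable (σ ν) in
/-- The inclusion of the superpolynomials in `x_s`, `y_n` as the superpolynomials in the variables
`x_{s,0}`, `y_{n,0}` of level zero. -/
def levelZero : SuperPoly σ ν →ₐ[ℂ] SuperPoly (σ × ℕ) (ν × ℕ) :=
  superEval (fun s => evenGen (ν × ℕ) (s, 0)) (fun _ => isEvenElt_evenGen _)
    (fun n => oddGen (σ × ℕ) (n, 0)) (fun _ => isOddElt_oddLin _)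

theorem parity_levelZero (b : SuperPoly σ ν) :
    parity _ _ (levelZero σ ν b) = levelZero σ ν (parity _ _ b) := by
  induction b using superPoly_induction with
  | hc c => simp only [AlgHom.commutes]
  | heven s =>
    rw [isEvenElt_evenGen]
    simp only [levelZero, superEval, superLift_evenGen]
    exact isEvenElt_evenGen _
  | hodd m =>
    rw [isOddElt_oddLin, map_neg]
    simp only [levelZero, superEval, superLift_oddLin]
    exact IsOddElt.linearCombination (fun _ => isOddElt_oddLin _) m
  | hmul a b ha hb => simp only [map_mul, ha, hb]
  | hadd a b ha hb => simp only [map_add, ha, hb]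

theorem IsEvenElt.levelZero {b : SuperPoly σ ν} (hb : IsEvenElt b) :
    IsEvenElt (ArcSuper.levelZero σ ν b) := by
  rw [IsEvenElt, parity_levelZero, hb]

theorem IsOddElt.levelZero {b : SuperPoly σ ν} (hb : IsOddElt b) :
    IsOddElt (ArcSuper.levelZero σ ν b) := by
  rw [IsOddElt, parity_levelZero, hb, map_neg]

/-- The homomorphism of differential superalgebras from the differential polynomial superalgebra
with `D^j X_t ↦ D^j α_t`. The generators of its source as a superalgebra are the
`X_{t,j} = D^j X_t / j!`. -/
def diffEval {τ₀ τ₁ : Type*} (a : τ₀ → SuperPoly (σ × ℕ) (ν × ℕ)) (ha : ∀ t, IsEvenElt (a t))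
    (b : τ₁ → SuperPoly (σ × ℕ) (ν × ℕ)) (hb : ∀ t, IsOddElt (b t)) :
    SuperPoly (τ₀ × ℕ) (τ₁ × ℕ) →ₐ[ℂ] SuperPoly (σ × ℕ) (ν × ℕ) :=
  superEval (fun q => ((q.2.factorial : ℂ)⁻¹) • (superD σ ν)^[q.2] (a q.1))
    (fun q => ((ha q.1).iterate_superD q.2).smul _)
    (fun q => ((q.2.factorial : ℂ)⁻¹) • (superD σ ν)^[q.2] (b q.1))
    (fun q => ((hb q.1).iterate_superD q.2).smul _)

/-- The differential subalgebra generated by a set: the smallest subalgebra that contains it and is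
closed under `D`. -/
def diffAdjoin {B : Type*} [Ring B] [Algebra ℂ B] (D : B →ₗ[ℂ] B) (s : Set B) : Subalgebra ℂ B :=
  sInf {A | s ⊆ A ∧ ∀ a ∈ A, D a ∈ A}

/-- The differential ideal generated by a set: the smallest two-sided ideal that contains it and is
closed under `D`. -/
def diffIdeal {B : Type*} [Ring B] [Algebra ℂ B] (D : B →ₗ[ℂ] B) (s : Set B) : TwoSidedIdeal B :=
  sInf {I | s ⊆ I ∧ ∀ a ∈ I, D a ∈ I}

end Differential

end ArcSuper

end

/-!
The proof compares `S^Ũ ⊗ L^U` with the coordinate rings of the arc spaces of `Ũ ⊕ U^k` by classical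
polarization and restitution, carried out with auxiliary odd variables `θ_p` in an algebra `Theta`.

* Polarization `y_n ↦ ∑ p < k, y_{p,n} ⊗ θ_p` (`polarizeFun`, and `polarizeArc` on arcs) is a
  homomorphism from superpolynomials to `ℂ[Ũ ⊕ U^k] ⊗ Theta`.
* Restitution `y_{p,n} ↦ y_n ⊗ θ_p` (`restitute`, and `exists_arcRestitute` on arcs) goes back to
  superpolynomials with coefficients in `Theta`. The tensor products are ungraded, so the products
  `y_n ⊗ θ_p` commute (`IsSuperComm.commute_tensor`).
* The composite is `y_n ↦ y_n ⊗ u` with `u = ∑ p < k, θ_p ⊗ θ_p`. As `u ^ k ≠ 0 = u ^ (k + 1)`, the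
  powers `1, u, …, u ^ k` are linearly independent, so that for `k` large a linear functional on
  `Theta ⊗ Theta` recovers any given element (`exists_contract_thetaSum`).

All these homomorphisms are equivariant and compatible with the derivations. Compatibility with the
derivations is expressed by arc families (`IsArc`), the coefficients of homomorphisms to power
series over rings that need not be commutative; by flatness an equivariant homomorphism `R → B ⊗ K`
restricts to `R^G → B^G ⊗ K` (`exists_coinvariants_restrict`).

For the first assertion (`coinvariants_eq_diffAdjoin`) an invariant is polarized, the result is by
hypothesis a polynomial in the `r⁽ʲ⁾` with `r ∈ ℂ[Ũ ⊕ U^k]^G`, and restitution sends these to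
elements with coefficients in the differential algebra generated by the classical invariants. That
this algebra consists of invariants is `superD_mem_coinvariants`.

For the second assertion (`ker_arcEval_eq_diffIdeal`) let `J` be the quotient of the
differential superpolynomials in the `X_t` by the differential ideal of `F`. It is supercommutative and receives the universal arc of the algebra of
classical invariants (`exists_arc_quotient`), so restitution also gives a homomorphism
`ℂ[J_∞((Ũ ⊕ U^k) // G)] → J ⊗ Theta`. A relation among the derivatives of the `α_t` polarizes to
zero in `ℂ[J_∞(Ũ ⊕ U^k)] ⊗ Theta`, hence by injectivity in `ℂ[J_∞((Ũ ⊕ U^k) // G)] ⊗ Theta`, and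
restitution shows that it is zero in `J` (`eq_zero_of_arcEval_eq_zero`).
-/

noncomputable section

open scoped TensorProduct
open Finset.HasAntidiagonal (antidiagonal)

namespace ArcSuper

/-! ### Arc families -/

/-- The coefficientwise product rule: the coefficient of `t ^ j` in the derivative of a product of
two power series. -/
theorem sum_antidiagonal_deriv {M : Type*} [AddCommGroup M] [Module ℂ M] (f : ℕ → ℕ → M) (j : ℕ) :
    ∑ q ∈ antidiagonal j, (((q.1 + 1 : ℕ) : ℂ) • f (q.1 + 1) q.2 +
        ((q.2 + 1 : ℕ) : ℂ) • f q.1 (q.2 + 1)) =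
      ((j + 1 : ℕ) : ℂ) • ∑ q ∈ antidiagonal (j + 1), f q.1 q.2 := by
  have h1 : ∑ q ∈ antidiagonal (j + 1), (q.1 : ℂ) • f q.1 q.2 =
      ∑ q ∈ antidiagonal j, ((q.1 + 1 : ℕ) : ℂ) • f (q.1 + 1) q.2 := by
    rw [Finset.Nat.sum_antidiagonal_succ]
    simp
  have h2 : ∑ q ∈ antidiagonal (j + 1), (q.2 : ℂ) • f q.1 q.2 =
      ∑ q ∈ antidiagonal j, ((q.2 + 1 : ℕ) : ℂ) • f q.1 (q.2 + 1) := by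
    rw [Finset.Nat.sum_antidiagonal_succ']
    simp
  rw [Finset.sum_add_distrib, ← h1, ← h2, ← Finset.sum_add_distrib, Finset.smul_sum]
  -- On the antidiagonal of `j + 1` the two weights add up to `j + 1`.
  refine Finset.sum_congr rfl fun q hq => ?_
  rw [← add_smul, ← Nat.cast_add, Finset.HasAntidiagonal.mem_antidiagonal.1 hq]

/-- The linear maps `γ j` are the coefficients of a homomorphism of algebras
`r ↦ ∑ j, γ j r tʲ` to the power series over `T`, where `T` need not be commutative. -/
structure IsArc {R T : Type*} [Ring R] [Algebra ℂ R] [Ring T] [Algebra ℂ T]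
    (γ : ℕ → R →ₗ[ℂ] T) : Prop where
  one : ∀ j, γ j 1 = if j = 0 then 1 else 0
  mul : ∀ r s j, γ j (r * s) = ∑ q ∈ antidiagonal j, γ q.1 r * γ q.2 s

section IsArc

variable {R T K : Type*} [Ring R] [Algebra ℂ R] [Ring T] [Algebra ℂ T] [Ring K] [Algebra ℂ K]
  {γ δ : ℕ → R →ₗ[ℂ] T}

theorem IsArc.map_algebraMap (hγ : IsArc γ) (c : ℂ) (j : ℕ) :
    γ j (algebraMap ℂ R c) = algebraMap ℂ T (if j = 0 then c else 0) := by
  rw [Algebra.algebraMap_eq_smul_one, map_smul, hγ.one]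
  split_ifs
  · rw [Algebra.algebraMap_eq_smul_one]
  · simp

theorem IsArc.comp (hγ : IsArc γ) (f : T →ₐ[ℂ] K) : IsArc fun j => f.toLinearMap ∘ₗ γ j where
  one j := by simp [hγ.one, apply_ite f]
  mul r s j := by simp [hγ.mul]

theorem IsArc.precomp (hγ : IsArc γ) (f : K →ₐ[ℂ] R) : IsArc fun j => γ j ∘ₗ f.toLinearMap where
  one j := by simp [hγ.one]
  mul r s j := by simp [hγ.mul]

theorem IsArc.rTensor (hγ : IsArc γ) (K : Type*) [Ring K] [Algebra ℂ K] :
    IsArc fun j => (γ j).rTensor K where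
  one j := by
    rw [Algebra.TensorProduct.one_def, LinearMap.rTensor_tmul, hγ.one]
    split_ifs
    · rfl
    · simp
  mul r s j := by
    induction r using TensorProduct.induction_on with
    | zero => simp
    | tmul r a =>
      induction s using TensorProduct.induction_on with
      | zero => simp
      | tmul s b => simp [hγ.mul, TensorProduct.sum_tmul]
      | add x y hx hy => simp only [mul_add, map_add, hx, hy, Finset.sum_add_distrib]
    | add x y hx hy => simp only [add_mul, map_add, hx, hy, Finset.sum_add_distrib]

/-- The elements at which two arc families agree form a subalgebra. -/
def IsArc.equalizer (hγ : IsArc γ) (hδ : IsArc δ) : Subalgebra ℂ R where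
  carrier := {r | ∀ j, γ j r = δ j r}
  mul_mem' ha hb j := by
    rw [hγ.mul, hδ.mul]
    exact Finset.sum_congr rfl fun q _ => by rw [ha, hb]
  add_mem' ha hb j := by rw [map_add, map_add, ha, hb]
  algebraMap_mem' c j := by rw [hγ.map_algebraMap, hδ.map_algebraMap]

theorem IsArc.exists_lift_of_comm {R T : Type*} [CommRing R] [Algebra ℂ R] [CommRing T]
    [Algebra ℂ T] {γ : ℕ → R →ₗ[ℂ] T} (hγ : IsArc γ) :
    ∃ Φ : ArcAlg R →ₐ[ℂ] T, ∀ r j, Φ (arcCoeff r j) = γ j r := by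
  let A : R →ₐ[ℂ] PowerSeries T := AlgHom.mk
    { toFun := fun r => PowerSeries.mk fun j => γ j r
      map_one' := by
        ext j
        rw [PowerSeries.coeff_mk, PowerSeries.coeff_one, hγ.one]
      map_mul' := fun r s => by
        ext j
        simp only [PowerSeries.coeff_mk, PowerSeries.coeff_mul, hγ.mul]
      map_zero' := by
        ext j
        simp
      map_add' := fun r s => by
        ext j
        simp }
    (fun c => by
      ext j
      refine (PowerSeries.coeff_mk j fun j => γ j (algebraMap ℂ R c)).trans ?_
      rw [hγ.map_algebraMap, PowerSeries.algebraMap_apply, PowerSeries.coeff_C]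
      split_ifs <;> simp)
  refine ⟨arcLift A, fun r j => ?_⟩
  rw [arcLift_arcCoeff]
  exact PowerSeries.coeff_mk j fun j => γ j r

/-- An arc family with commuting values is a point of the arc space. -/
theorem IsArc.exists_lift {R : Type*} [CommRing R] [Algebra ℂ R] {γ : ℕ → R →ₗ[ℂ] T}
    (hγ : IsArc γ) (hc : ∀ i j r s, γ i r * γ j s = γ j s * γ i r) :
    ∃ Φ : ArcAlg R →ₐ[ℂ] T, ∀ r j, Φ (arcCoeff r j) = γ j r := by
  -- The subalgebra generated by the values is commutative, so the universal property applies to it.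
  let X : Set T := {x | ∃ j r, γ j r = x}
  have hS : IsMulCommutative (Algebra.adjoin ℂ X) := Algebra.isMulCommutative_adjoin ℂ (by
    rintro _ ⟨i, r, rfl⟩ _ ⟨j, s, rfl⟩
    exact hc i j r s)
  let i₁ : CommRing (Algebra.adjoin ℂ X) :=
    { (Algebra.adjoin ℂ X).toRing with mul_comm := hS.is_comm.comm }
  let g : ℕ → R →ₗ[ℂ] Algebra.adjoin ℂ X := fun j =>
    (γ j).codRestrict (Subalgebra.toSubmodule (Algebra.adjoin ℂ X))
      fun r => Algebra.subset_adjoin ⟨j, r, rfl⟩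
  obtain ⟨Φ, hΦ⟩ := IsArc.exists_lift_of_comm (γ := g)
    { one := fun j => by
        refine Subtype.ext ((hγ.one j).trans ?_)
        split_ifs <;> rfl
      mul := fun r s j => by
        refine Subtype.ext ((hγ.mul r s j).trans ?_)
        rw [← Subalgebra.coe_val, map_sum]
        rfl }
  exact ⟨(Algebra.adjoin ℂ X).val.comp Φ, fun r j => congrArg Subtype.val (hΦ r j)⟩

end IsArc

section ArcFam

variable (R : Type*) [CommRing R] [Algebra ℂ R]

/-- The universal arc family `r ↦ r⁽ʲ⁾`. -/
def arcFam (j : ℕ) : R →ₗ[ℂ] ArcAlg R :=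
  ((PowerSeries.coeff (R := ArcAlg R) j).restrictScalars ℂ) ∘ₗ (arcUniv R).toLinearMap

@[simp]
theorem arcFam_apply (j : ℕ) (r : R) : arcFam R j r = arcCoeff r j := by
  simp [arcFam]

theorem isArc_arcFam : IsArc (arcFam R) where
  one j := by
    rw [arcFam_apply, ← map_one (algebraMap ℂ R), arcCoeff_algebraMap]
    split_ifs <;> simp
  mul r s j := by simp only [arcFam_apply, arcCoeff_mul]

/-- The homomorphism to the dual numbers that sends `r⁽ʲ⁾` to `r⁽ʲ⁾ + ε (j + 1) r⁽ʲ⁺¹⁾`. -/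
theorem exists_arcDual : ∃ Φ : ArcAlg R →ₐ[ℂ] DualNumber (ArcAlg R), ∀ r j,
    Φ (arcCoeff r j) = TrivSqZeroExt.inl (arcCoeff r j) +
      TrivSqZeroExt.inr (((j + 1 : ℕ) : ℂ) • arcCoeff r (j + 1)) := by
  have h1 : ∀ j, arcCoeff (1 : R) j = if j = 0 then 1 else 0 := fun j => by
    rw [← arcFam_apply, (isArc_arcFam R).one]
  let γ : ℕ → R →ₗ[ℂ] DualNumber (ArcAlg R) := fun j =>
    (TrivSqZeroExt.inlAlgHom ℂ (ArcAlg R) (ArcAlg R)).toLinearMap ∘ₗ arcFam R j +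
      ((j + 1 : ℕ) : ℂ) • ((TrivSqZeroExt.inrHom (ArcAlg R) (ArcAlg R)).restrictScalars ℂ) ∘ₗ
        arcFam R (j + 1)
  have hγ : ∀ r j, γ j r = TrivSqZeroExt.inl (arcCoeff r j) +
      TrivSqZeroExt.inr (((j + 1 : ℕ) : ℂ) • arcCoeff r (j + 1)) := fun r j => by
    simp [γ]
  obtain ⟨Φ, hΦ⟩ := IsArc.exists_lift (γ := γ)
    { one := fun j => by
        rw [hγ, h1, h1]
        ext <;> by_cases hj : j = 0 <;> simp [hj]
      mul := fun r s j => by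
        simp only [hγ]
        ext
        · simp only [TrivSqZeroExt.fst_add, TrivSqZeroExt.fst_inl, TrivSqZeroExt.fst_inr, add_zero,
            TrivSqZeroExt.fst_sum, TrivSqZeroExt.fst_mul, arcCoeff_mul]
        · simp only [TrivSqZeroExt.snd_add, TrivSqZeroExt.snd_inl, TrivSqZeroExt.snd_inr, zero_add,
            TrivSqZeroExt.snd_sum, TrivSqZeroExt.snd_mul, TrivSqZeroExt.fst_add,
            TrivSqZeroExt.fst_inl, TrivSqZeroExt.fst_inr, add_zero, arcCoeff_mul]
          rw [← sum_antidiagonal_deriv fun p q => arcCoeff r p * arcCoeff s q]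
          refine Finset.sum_congr rfl fun q _ => ?_
          simp [mul_comm, add_comm] }
    (fun i j r s => mul_comm _ _)
  exact ⟨Φ, fun r j => (hΦ r j).trans (hγ r j)⟩

/-- The coordinate ring of an arc space has a derivation with `D r⁽ʲ⁾ = (j + 1) r⁽ʲ⁺¹⁾`. -/
theorem exists_arcDer : ∃ D : ArcAlg R →ₗ[ℂ] ArcAlg R,
    (∀ x y, D (x * y) = x * D y + D x * y) ∧
      ∀ r j, D (arcCoeff r j) = ((j + 1 : ℕ) : ℂ) • arcCoeff r (j + 1) := by
  obtain ⟨Φ, hΦ⟩ := exists_arcDual R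
  have hfst : ∀ x, (Φ x).fst = x := by
    have h : (TrivSqZeroExt.fstHom ℂ (ArcAlg R) (ArcAlg R)).comp Φ = AlgHom.id ℂ _ :=
      arcAlg_hom_ext fun r j => by simp [hΦ]
    exact DFunLike.congr_fun h
  refine ⟨{ toFun := fun x => (Φ x).snd
            map_add' := fun x y => by simp
            map_smul' := fun c x => by simp }, fun x y => ?_, fun r j => ?_⟩
  · simp [hfst, mul_comm]
  · simp [hΦ]

end ArcFam

/-! ### Supercommutativity -/

/-- The algebra `A`, with the parity automorphism `π`, is supercommutative: the even elements
`x + π x` are central and the odd elements `x - π x` commute up to parity with every element. -/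
structure IsSuperComm {A : Type*} [Ring A] [Algebra ℂ A] (π : A →ₐ[ℂ] A) : Prop where
  invol : ∀ x, π (π x) = x
  even : ∀ x y, (x + π x) * y = y * (x + π x)
  odd : ∀ x y, (x - π x) * y = π y * (x - π x)

section IsSuperComm

variable {A K : Type*} [Ring A] [Algebra ℂ A] [Ring K] [Algebra ℂ K] {π : A →ₐ[ℂ] A}

theorem IsSuperComm.mem_center (h : IsSuperComm π) {x : A} (hx : π x = x) :
    x ∈ Subalgebra.center ℂ A := by
  rw [Subalgebra.mem_center_iff]
  intro y
  have h2 := h.even x y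
  rw [hx, ← two_smul ℂ x, smul_mul_assoc, mul_smul_comm] at h2
  exact (smul_right_injective A (two_ne_zero' ℂ) h2).symm

theorem IsSuperComm.mul_self (h : IsSuperComm π) {x : A} (hx : π x = -x) : x * x = 0 := by
  have h2 := h.odd x x
  rw [hx, sub_neg_eq_add, ← two_smul ℂ x, smul_mul_assoc, mul_smul_comm] at h2
  refine mul_self_eq_zero_of_neg ?_
  rw [← neg_mul]
  exact smul_right_injective A (two_ne_zero' ℂ) h2

theorem IsSuperComm.mul_self_linearCombination (h : IsSuperComm π) {τ : Type*} {b : τ → A}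
    (hb : ∀ t, π (b t) = -b t) (m : τ →₀ ℂ) :
    Finsupp.linearCombination ℂ b m * Finsupp.linearCombination ℂ b m = 0 := by
  refine h.mul_self ?_
  simp only [Finsupp.linearCombination_apply, Finsupp.sum, map_sum, map_smul, hb, smul_neg,
    Finset.sum_neg_distrib]

theorem isSuperComm_parity (σ ν : Type*) : IsSuperComm (parity σ ν) := by
  have hinv : ∀ x, parity σ ν (parity σ ν x) = x := by
    intro x
    induction x using superPoly_induction with
    | hc c => simp
    | heven s => rw [isEvenElt_evenGen, isEvenElt_evenGen]
    | hodd m => rw [isOddElt_oddLin, map_neg, isOddElt_oddLin, neg_neg]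
    | hmul a b ha hb => simp [ha, hb]
    | hadd a b ha hb => simp [ha, hb]
  refine ⟨hinv, fun x y => ?_, fun x y => ?_⟩
  · have h : IsEvenElt (x + parity σ ν x) := by simp [IsEvenElt, hinv, add_comm]
    exact ((Subalgebra.mem_center_iff.1 h.mem_center) y).symm
  · have h : IsOddElt (x - parity σ ν x) := by simp [IsOddElt, hinv]
    exact h.mul_eq y

theorem IsSuperComm.of_surjective (h : IsSuperComm π) {π' : K →ₐ[ℂ] K} (f : A →ₐ[ℂ] K)
    (hf : Function.Surjective f) (hπ : ∀ x, π' (f x) = f (π x)) : IsSuperComm π' := by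
  refine ⟨fun x => ?_, fun x y => ?_, fun x y => ?_⟩
  · obtain ⟨x, rfl⟩ := hf x
    rw [hπ, hπ, h.invol]
  · obtain ⟨x, rfl⟩ := hf x
    obtain ⟨y, rfl⟩ := hf y
    rw [hπ, ← map_add, ← map_mul, h.even, map_mul]
  · obtain ⟨x, rfl⟩ := hf x
    obtain ⟨y, rfl⟩ := hf y
    rw [hπ, hπ, ← map_sub, ← map_mul, h.odd, map_mul]

theorem IsSuperComm.tensor_right (h : IsSuperComm π) (K : Type*) [CommRing K] [Algebra ℂ K] :
    IsSuperComm (Algebra.TensorProduct.map π (AlgHom.id ℂ K)) := by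
  refine ⟨fun x => ?_, fun x y => ?_, fun x y => ?_⟩
  · induction x using TensorProduct.induction_on with
    | zero => simp
    | tmul x a => simp [h.invol]
    | add x y hx hy => rw [map_add, map_add, hx, hy]
  · induction x using TensorProduct.induction_on with
    | zero => simp
    | tmul x a =>
      induction y using TensorProduct.induction_on with
      | zero => simp
      | tmul y b =>
        rw [Algebra.TensorProduct.map_tmul, AlgHom.id_apply, ← TensorProduct.add_tmul,
          Algebra.TensorProduct.tmul_mul_tmul, Algebra.TensorProduct.tmul_mul_tmul, h.even,
          mul_comm a b]
      | add y z hy hz => rw [mul_add, hy, hz, add_mul]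
    | add x z hx hz => rw [map_add, add_add_add_comm, add_mul, mul_add, hx, hz]
  · induction x using TensorProduct.induction_on with
    | zero => simp
    | tmul x a =>
      induction y using TensorProduct.induction_on with
      | zero => simp
      | tmul y b =>
        rw [Algebra.TensorProduct.map_tmul, Algebra.TensorProduct.map_tmul, AlgHom.id_apply,
          AlgHom.id_apply, ← TensorProduct.sub_tmul,
          Algebra.TensorProduct.tmul_mul_tmul, Algebra.TensorProduct.tmul_mul_tmul, h.odd,
          mul_comm a b]
      | add y z hy hz => rw [mul_add, hy, hz, map_add, add_mul]
    | add x z hx hz => rw [map_add, add_sub_add_comm, add_mul, mul_add, hx, hz]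

theorem IsSuperComm.tensor_left (h : IsSuperComm π) (K : Type*) [CommRing K] [Algebra ℂ K] :
    IsSuperComm (Algebra.TensorProduct.map (AlgHom.id ℂ K) π) := by
  refine (h.tensor_right K).of_surjective (Algebra.TensorProduct.comm ℂ A K).toAlgHom
    (Algebra.TensorProduct.comm ℂ A K).surjective fun x => ?_
  induction x using TensorProduct.induction_on with
  | zero => simp
  | tmul x a => simp
  | add x y hx hy => rw [map_add, map_add, map_add, map_add, hx, hy]

/-- In an ungraded tensor product of supercommutative algebras the elements of total parity zero
commute, as the signs from the two factors cancel. -/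
theorem IsSuperComm.commute_tensor (h : IsSuperComm π) {π' : K →ₐ[ℂ] K} (h' : IsSuperComm π')
    {z w : A ⊗[ℂ] K} (hz : Algebra.TensorProduct.map π π' z = z)
    (hw : Algebra.TensorProduct.map π π' w = w) : z * w = w * z := by
  -- The claim is bilinear once it is stated for the sums `z + (π ⊗ π') z`, which for the given
  -- elements are `2 z`.
  have key : ∀ z w : A ⊗[ℂ] K,
      (z + Algebra.TensorProduct.map π π' z) * (w + Algebra.TensorProduct.map π π' w) =
        (w + Algebra.TensorProduct.map π π' w) * (z + Algebra.TensorProduct.map π π' z) := by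
    intro z w
    induction z using TensorProduct.induction_on with
    | zero => simp
    | add x y hx hy =>
      rw [map_add, add_add_add_comm, add_mul (x + _) (y + _), hx, hy,
        mul_add (w + _) (x + _) (y + _)]
    | tmul x a =>
      induction w using TensorProduct.induction_on with
      | zero => simp
      | add y v hy hv =>
        rw [map_add, add_add_add_comm, mul_add _ (y + _) (v + _), hy, hv,
          add_mul (y + _) (v + _)]
      | tmul y b =>
        have split : ∀ (x : A) (a : K), (2 : ℂ) • (x ⊗ₜ[ℂ] a + π x ⊗ₜ[ℂ] π' a) =
            (x + π x) ⊗ₜ[ℂ] (a + π' a) + (x - π x) ⊗ₜ[ℂ] (a - π' a) := by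
          intro x a
          simp only [TensorProduct.add_tmul, TensorProduct.tmul_add, TensorProduct.sub_tmul,
            TensorProduct.tmul_sub, two_smul]
          abel
        have hpo : ∀ x, π (x - π x) = -(x - π x) := fun x => by
          rw [map_sub, h.invol, neg_sub]
        have hpo' : ∀ x, π' (x - π' x) = -(x - π' x) := fun x => by
          rw [map_sub, h'.invol, neg_sub]
        refine smul_right_injective _ (two_ne_zero' ℂ) (smul_right_injective _ (two_ne_zero' ℂ) ?_)
        simp only [Algebra.TensorProduct.map_tmul]
        rw [← smul_mul_assoc, ← mul_smul_comm, ← smul_mul_assoc, ← mul_smul_comm, split, split]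
        have e1 := h.even x (y + π y)
        have e2 := h'.even a (b + π' b)
        have e3 := h.even x (y - π y)
        have e4 := h'.even a (b - π' b)
        have e5 := h.even y (x - π x)
        have e6 := h'.even b (a - π' a)
        have e7 := h.odd x (y - π y)
        have e8 := h'.odd a (b - π' b)
        rw [hpo] at e7
        rw [hpo'] at e8
        generalize x + π x = x₀, y + π y = y₀, x - π x = x₁, y - π y = y₁, a + π' a = a₀,
          b + π' b = b₀, a - π' a = a₁, b - π' b = b₁ at *
        simp only [add_mul, mul_add, Algebra.TensorProduct.tmul_mul_tmul]
        rw [e1, e2, e3, e4, e5, e6, e7, e8, neg_mul, neg_mul, TensorProduct.neg_tmul,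
          TensorProduct.tmul_neg, neg_neg]
        abel
  have h4 := key z w
  rw [hz, hw, ← two_smul ℂ z, ← two_smul ℂ w, smul_mul_assoc, mul_smul_comm, smul_mul_assoc,
    mul_smul_comm] at h4
  exact smul_right_injective _ (two_ne_zero' ℂ) (smul_right_injective _ (two_ne_zero' ℂ) h4)

end IsSuperComm

/-! ### Superpolynomials and their arcs -/

section Generators

variable {σ ν : Type*}

@[elab_as_elim]
theorem superPoly_induction_gen {C : SuperPoly σ ν → Prop}
    (hc : ∀ c : ℂ, C (algebraMap ℂ _ c)) (heven : ∀ s, C (evenGen ν s))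
    (hodd : ∀ n, C (oddGen σ n)) (hmul : ∀ a b, C a → C b → C (a * b))
    (hadd : ∀ a b, C a → C b → C (a + b)) (b : SuperPoly σ ν) : C b := by
  induction b using superPoly_induction with
  | hc c => exact hc c
  | heven s => exact heven s
  | hmul a b ha hb => exact hmul a b ha hb
  | hadd a b ha hb => exact hadd a b ha hb
  | hodd m =>
    induction m using Finsupp.induction_linear with
    | zero => simpa using hc 0
    | add f g hf hg => rw [map_add]; exact hadd _ _ hf hg
    | single n c =>
      have h : oddLin σ (Finsupp.single n c) = algebraMap ℂ _ c * oddGen σ n := by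
        rw [oddGen, ← Algebra.smul_def, ← map_smul, Finsupp.smul_single, smul_eq_mul, mul_one]
      rw [h]
      exact hmul _ _ (hc c) (hodd n)

theorem superPoly_hom_ext {A : Type*} [Ring A] [Algebra ℂ A] {f g : SuperPoly σ ν →ₐ[ℂ] A}
    (heven : ∀ s, f (evenGen ν s) = g (evenGen ν s))
    (hodd : ∀ n, f (oddGen σ n) = g (oddGen σ n)) : f = g := by
  ext b
  induction b using superPoly_induction_gen with
  | hc c => simp
  | heven s => exact heven s
  | hodd n => exact hodd n
  | hmul a b ha hb => simp [ha, hb]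
  | hadd a b ha hb => simp [ha, hb]

theorem IsArc.superPoly_ext {T : Type*} [Ring T] [Algebra ℂ T] {γ δ : ℕ → SuperPoly σ ν →ₗ[ℂ] T}
    (hγ : IsArc γ) (hδ : IsArc δ) (heven : ∀ j s, γ j (evenGen ν s) = δ j (evenGen ν s))
    (hodd : ∀ j n, γ j (oddGen σ n) = δ j (oddGen σ n)) (j : ℕ) (b : SuperPoly σ ν) :
    γ j b = δ j b := by
  suffices h : b ∈ hγ.equalizer hδ from h j
  induction b using superPoly_induction_gen with
  | hc c => exact Subalgebra.algebraMap_mem _ c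
  | heven s => exact fun j => heven j s
  | hodd n => exact fun j => hodd j n
  | hmul a b ha hb => exact mul_mem ha hb
  | hadd a b ha hb => exact add_mem ha hb

@[simp]
theorem parity_evenGen (s : σ) : parity σ ν (evenGen ν s) = evenGen ν s := isEvenElt_evenGen s

@[simp]
theorem parity_oddGen (n : ν) : parity σ ν (oddGen σ n) = -oddGen σ n := isOddElt_oddLin _

theorem oddGen_mul_self (n : ν) : oddGen σ n * oddGen σ n = 0 := oddLin_mul_self _

theorem oddGen_swap (m n : ν) : oddGen σ m * oddGen σ n = -(oddGen σ n * oddGen σ m) :=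
  oddLin_swap _ _

end Generators

section DivPow

variable {B : Type*} [Ring B] [Algebra ℂ B]

/-- The divided powers `Dʲ / j!` of a linear endomorphism. -/
def divPow (D : B →ₗ[ℂ] B) (j : ℕ) : B →ₗ[ℂ] B := ((j.factorial : ℂ)⁻¹) • D ^ j

theorem divPow_apply (D : B →ₗ[ℂ] B) (j : ℕ) (x : B) :
    divPow D j x = ((j.factorial : ℂ)⁻¹) • D^[j] x := by
  simp [divPow, Module.End.pow_apply]

theorem divPow_zero (D : B →ₗ[ℂ] B) (x : B) : divPow D 0 x = x := by simp [divPow]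

theorem apply_divPow (D : B →ₗ[ℂ] B) (j : ℕ) (x : B) :
    D (divPow D j x) = ((j + 1 : ℕ) : ℂ) • divPow D (j + 1) x := by
  rw [divPow_apply, divPow_apply, map_smul, ← Function.iterate_succ_apply' D, smul_smul]
  congr 1
  rw [Nat.factorial_succ, Nat.cast_mul, mul_inv, ← mul_assoc, mul_inv_cancel₀, one_mul]
  exact_mod_cast j.succ_ne_zero

theorem divPow_succ (D : B →ₗ[ℂ] B) (j : ℕ) (x : B) :
    divPow D (j + 1) x = (((j + 1 : ℕ) : ℂ)⁻¹) • D (divPow D j x) := by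
  rw [apply_divPow, smul_smul, inv_mul_cancel₀, one_smul]
  exact_mod_cast j.succ_ne_zero

theorem divPow_mem {D : B →ₗ[ℂ] B} {S : Submodule ℂ B} (hS : ∀ x ∈ S, D x ∈ S) {x : B}
    (hx : x ∈ S) (j : ℕ) : divPow D j x ∈ S := by
  induction j with
  | zero => rwa [divPow_zero]
  | succ j ih =>
    rw [divPow_succ]
    exact S.smul_mem _ (hS _ ih)

/-- Taylor's formula: `x ↦ ∑ j, (Dʲ x / j!) tʲ` is multiplicative for a derivation `D`. -/
theorem isArc_divPow {D : B →ₗ[ℂ] B} (hD : ∀ x y, D (x * y) = x * D y + D x * y) :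
    IsArc (divPow D) where
  one j := by
    have h1 : D 1 = 0 := by
      have h := hD 1 1
      rw [mul_one, mul_one, one_mul] at h
      exact left_eq_add.1 h
    induction j with
    | zero => simp [divPow_zero]
    | succ j ih =>
      rw [divPow_succ, ih, if_neg j.succ_ne_zero]
      split_ifs <;> simp [h1]
  mul x y j := by
    induction j with
    | zero => simp [divPow_zero]
    | succ j ih =>
      have hj : ((j + 1 : ℕ) : ℂ) ≠ 0 := by exact_mod_cast j.succ_ne_zero
      refine smul_right_injective B hj ?_
      simp only
      rw [← apply_divPow, ih, map_sum,
        ← sum_antidiagonal_deriv fun p q => divPow D p x * divPow D q y]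
      refine Finset.sum_congr rfl fun q _ => ?_
      rw [hD, apply_divPow, apply_divPow, mul_smul_comm, smul_mul_assoc, add_comm]

end DivPow

section SuperArc

variable (σ ν : Type*)

/-- The arc family `b ↦ Dʲ b / j!` from the superpolynomials in the variables of level zero. -/
def superArc (j : ℕ) : SuperPoly σ ν →ₗ[ℂ] SuperPoly (σ × ℕ) (ν × ℕ) :=
  divPow (superD σ ν) j ∘ₗ (levelZero σ ν).toLinearMap

theorem isArc_superArc : IsArc (superArc σ ν) :=
  (isArc_divPow superD_mul).precomp (levelZero σ ν)

variable {σ ν}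

theorem superD_oddGen (n : ν) (j : ℕ) :
    superD σ ν (oddGen (σ × ℕ) (n, j)) = ((j + 1 : ℕ) : ℂ) • oddGen (σ × ℕ) (n, j + 1) := by
  rw [oddGen, superD_oddLin, oddGen, ← map_smul, Finsupp.smul_single]
  simp [shiftD]

theorem levelZero_evenGen (s : σ) : levelZero σ ν (evenGen ν s) = evenGen (ν × ℕ) (s, 0) :=
  superLift_evenGen _ _ _ _ s

theorem levelZero_oddGen (n : ν) : levelZero σ ν (oddGen σ n) = oddGen (σ × ℕ) (n, 0) :=
  superLift_oddGen _ _ _ _ n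

@[simp]
theorem superArc_evenGen (s : σ) (j : ℕ) :
    superArc σ ν j (evenGen ν s) = evenGen (ν × ℕ) (s, j) := by
  change divPow (superD σ ν) j (levelZero σ ν (evenGen ν s)) = _
  rw [levelZero_evenGen]
  induction j with
  | zero => rw [divPow_zero]
  | succ j ih =>
    rw [divPow_succ, ih, superD_evenGen, smul_smul, inv_mul_cancel₀, one_smul]
    exact_mod_cast j.succ_ne_zero

@[simp]
theorem superArc_oddGen (n : ν) (j : ℕ) :
    superArc σ ν j (oddGen σ n) = oddGen (σ × ℕ) (n, j) := by
  change divPow (superD σ ν) j (levelZero σ ν (oddGen σ n)) = _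
  rw [levelZero_oddGen]
  induction j with
  | zero => rw [divPow_zero]
  | succ j ih =>
    rw [divPow_succ, ih, superD_oddGen, smul_smul, inv_mul_cancel₀, one_smul]
    exact_mod_cast j.succ_ne_zero

theorem parity_superArc (j : ℕ) (b : SuperPoly σ ν) :
    parity _ _ (superArc σ ν j b) = superArc σ ν j (parity _ _ b) := by
  change parity _ _ (divPow (superD σ ν) j (levelZero σ ν b)) =
    divPow (superD σ ν) j (levelZero σ ν (parity _ _ b))
  rw [← parity_levelZero]
  generalize levelZero σ ν b = x
  induction j with
  | zero => rw [divPow_zero, divPow_zero]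
  | succ j ih => rw [divPow_succ, divPow_succ, map_smul, parity_superD, ih]

end SuperArc

/-! ### Tensor products -/

section Contract

variable {M N K : Type*} [AddCommGroup M] [Module ℂ M] [AddCommGroup N] [Module ℂ N]
  [AddCommGroup K] [Module ℂ K]

variable (M) in
/-- Contraction of the second factor of a tensor product with a linear functional. -/
def contract (φ : K →ₗ[ℂ] ℂ) : M ⊗[ℂ] K →ₗ[ℂ] M :=
  (TensorProduct.rid ℂ M).toLinearMap ∘ₗ φ.lTensor M

@[simp]
theorem contract_tmul (φ : K →ₗ[ℂ] ℂ) (m : M) (k : K) : contract M φ (m ⊗ₜ k) = φ k • m := by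
  simp [contract]

theorem contract_rTensor (φ : K →ₗ[ℂ] ℂ) (f : M →ₗ[ℂ] N) (z : M ⊗[ℂ] K) :
    contract N φ (f.rTensor K z) = f (contract M φ z) := by
  induction z using TensorProduct.induction_on with
  | zero => simp
  | tmul m k => simp
  | add x y hx hy => simp [hx, hy]

theorem rTensor_injective_of_field (K : Type*) [AddCommGroup K] [Module ℂ K] {f : M →ₗ[ℂ] N}
    (hf : Function.Injective f) : Function.Injective (f.rTensor K) :=
  Module.Flat.rTensor_preserves_injective_linearMap f hf

end Contract

section Equivariant

variable {O B R K : Type*} [CommRing O] [Algebra ℂ O] [Ring B] [Algebra ℂ B] [Ring R] [Algebra ℂ R]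
  [Ring K] [Algebra ℂ K]

/-- As `K` is flat, the invariants of `B ⊗ K`, where the group acts on `B` alone, are
`B^G ⊗ K`. -/
theorem mem_range_of_coinvariant (c : B →ₐ[ℂ] O ⊗[ℂ] B) {z : B ⊗[ℂ] K}
    (hz : Algebra.TensorProduct.map c (AlgHom.id ℂ K) z =
      Algebra.TensorProduct.map
        (Algebra.TensorProduct.includeRight : B →ₐ[ℂ] O ⊗[ℂ] B) (AlgHom.id ℂ K) z) :
    ∃ w : coinvariants c ⊗[ℂ] K,
      Algebra.TensorProduct.map (coinvariants c).val (AlgHom.id ℂ K) w = z := by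
  let d : B →ₗ[ℂ] O ⊗[ℂ] B :=
    c.toLinearMap - (Algebra.TensorProduct.includeRight : B →ₐ[ℂ] O ⊗[ℂ] B).toLinearMap
  have hex : Function.Exact (coinvariants c).val.toLinearMap d := by
    intro b
    constructor
    · intro h
      exact ⟨⟨b, sub_eq_zero.1 h⟩, rfl⟩
    · rintro ⟨b, rfl⟩
      exact sub_eq_zero.2 b.2
  refine (Module.Flat.rTensor_exact K hex z).1 ?_
  rw [LinearMap.rTensor_sub, LinearMap.sub_apply]
  exact sub_eq_zero.2 hz

theorem coinvariants_map_injective (c : B →ₐ[ℂ] O ⊗[ℂ] B) (K : Type*) [Ring K] [Algebra ℂ K] :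
    Function.Injective (Algebra.TensorProduct.map (coinvariants c).val (AlgHom.id ℂ K)) :=
  rTensor_injective_of_field K (f := (coinvariants c).val.toLinearMap) Subtype.val_injective

/-- A homomorphism `f : R → B ⊗ K` that is equivariant, the group acting trivially on `K`,
restricts to `R^G → B^G ⊗ K`. -/
theorem exists_coinvariants_restrict (c : B →ₐ[ℂ] O ⊗[ℂ] B) (c' : R →ₐ[ℂ] O ⊗[ℂ] R)
    (f : R →ₐ[ℂ] B ⊗[ℂ] K)
    (hf : ((Algebra.TensorProduct.assoc ℂ ℂ ℂ O B K).toAlgHom.comp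
      (Algebra.TensorProduct.map c (AlgHom.id ℂ K))).comp f =
        (Algebra.TensorProduct.map (AlgHom.id ℂ O) f).comp c') :
    ∃ g : coinvariants c' →ₐ[ℂ] coinvariants c ⊗[ℂ] K, ∀ r,
      Algebra.TensorProduct.map (coinvariants c).val (AlgHom.id ℂ K) (g r) = f r := by
  have hr : ∀ r : coinvariants c', f r ∈
      (Algebra.TensorProduct.map (coinvariants c).val (AlgHom.id ℂ K)).range := by
    intro r
    refine mem_range_of_coinvariant c ((Algebra.TensorProduct.assoc ℂ ℂ ℂ O B K).injective ?_)
    refine (DFunLike.congr_fun hf (r : R)).trans ?_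
    have h : c' r = 1 ⊗ₜ (r : R) := r.2
    rw [AlgHom.comp_apply, h, Algebra.TensorProduct.map_tmul, map_one]
    generalize f r = z
    induction z using TensorProduct.induction_on with
    | zero => simp
    | tmul b k => simp
    | add x y hx hy => rw [TensorProduct.tmul_add, hx, hy, map_add, map_add]
  let e := AlgEquiv.ofInjective _ (coinvariants_map_injective c K)
  refine ⟨e.symm.toAlgHom.comp ((f.comp (coinvariants c').val).codRestrict _ hr), fun r => ?_⟩
  have h := e.apply_symm_apply ((f.comp (coinvariants c').val).codRestrict _ hr r)
  exact congrArg Subtype.val h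

end Equivariant

/-! ### The auxiliary odd variables -/

/-- The exterior algebra on countably many auxiliary odd variables `θ_p`, as the superpolynomials
without even variables. -/
abbrev Theta : Type := SuperPoly Empty ℕ

/-- The product `θ_0 ⋯ θ_{m-1}`. -/
def thetaProd : ℕ → Theta
  | 0 => 1
  | m + 1 => thetaProd m * oddGen Empty m

theorem thetaProd_ne_zero (m : ℕ) : thetaProd m ≠ 0 := by
  have h1 : ∀ m, thetaProd m = oddIncl Empty (ExteriorAlgebra.ιMulti ℂ m
      fun p : Fin m => Finsupp.single (p : ℕ) (1 : ℂ)) := by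
    intro m
    induction m with
    | zero => simp [thetaProd]
    | succ m ih =>
      rw [thetaProd, ih, ExteriorAlgebra.ιMulti_apply, ExteriorAlgebra.ιMulti_apply,
        List.ofFn_succ', List.concat_eq_append, List.prod_append, map_mul, List.prod_singleton]
      rfl
  rw [h1]
  have hinj : Function.Injective (oddIncl (ν := ℕ) Empty) :=
    (superEquiv Empty ℕ).injective.comp
      (Algebra.TensorProduct.includeRight_injective
        (algebraMap ℂ (MvPolynomial Empty ℂ)).injective)
  rw [Ne, map_eq_zero_iff _ hinj]
  intro h
  -- The determinant of the first `m` coordinates takes the value `1` on the product.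
  let f : (ℕ →₀ ℂ) →ₗ[ℂ] (Fin m → ℂ) := LinearMap.pi fun p => Finsupp.lapply (p : ℕ)
  let d : ∀ i, (ℕ →₀ ℂ) [⋀^Fin i]→ₗ[ℂ] ℂ := fun i =>
    if hi : i = m then
      ((Matrix.detRowAlternating (R := ℂ) (n := Fin m)).compLinearMap f).domDomCongr
        (finCongr hi.symm)
    else 0
  have h2 := congrArg (ExteriorAlgebra.liftAlternating d) h
  rw [ExteriorAlgebra.liftAlternating_apply_ιMulti, map_zero] at h2
  simp only [d, dif_pos] at h2
  have h3 : (fun p : Fin m => f (Finsupp.single (p : ℕ) (1 : ℂ))) =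
      (1 : Matrix (Fin m) (Fin m) ℂ) := by
    ext p q
    simp [f, Finsupp.single_apply, Matrix.one_apply, Fin.ext_iff]
  have h4 : Matrix.det (fun p : Fin m => f (Finsupp.single (p : ℕ) (1 : ℂ))) = 0 := h2
  rw [h3, Matrix.det_one] at h4
  exact one_ne_zero h4

/-- The even element `∑ p < k, θ_p ⊗ θ_p`. -/
def thetaSum (k : ℕ) : Theta ⊗[ℂ] Theta :=
  ∑ p ∈ Finset.range k, oddGen Empty p ⊗ₜ[ℂ] oddGen Empty p

theorem commute_theta (p q : ℕ) :
    Commute ((oddGen Empty p : Theta) ⊗ₜ[ℂ] (oddGen Empty p : Theta))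
      (oddGen Empty q ⊗ₜ[ℂ] oddGen Empty q) := by
  rw [Commute, SemiconjBy, Algebra.TensorProduct.tmul_mul_tmul,
    Algebra.TensorProduct.tmul_mul_tmul, oddGen_swap p q, TensorProduct.neg_tmul,
    TensorProduct.tmul_neg, neg_neg]

/-- Each new summand squares to zero and commutes with the others, so only the last two terms of
the binomial expansion can contribute. -/
theorem thetaSum_pow (k : ℕ) : thetaSum k ^ (k + 1) = 0 ∧
    thetaSum k ^ k = (k.factorial : ℂ) • thetaProd k ⊗ₜ[ℂ] thetaProd k := by
  induction k with
  | zero => simp [thetaSum, thetaProd, Algebra.TensorProduct.one_def]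
  | succ k ih =>
    have hz : ((oddGen Empty k : Theta) ⊗ₜ[ℂ] (oddGen Empty k : Theta)) ^ 2 = 0 := by
      rw [pow_two, Algebra.TensorProduct.tmul_mul_tmul, oddGen_mul_self, TensorProduct.zero_tmul]
    have hs : thetaSum (k + 1) = thetaSum k + oddGen Empty k ⊗ₜ[ℂ] oddGen Empty k :=
      Finset.sum_range_succ _ _
    have hc : Commute (thetaSum k) (oddGen Empty k ⊗ₜ[ℂ] oddGen Empty k) :=
      Commute.sum_left _ _ _ fun p _ => commute_theta p k
    have hk : thetaSum (k + 1) ^ (k + 1) = (((k + 1).factorial : ℕ) : ℂ) •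
        thetaProd (k + 1) ⊗ₜ[ℂ] thetaProd (k + 1) := by
      rw [hs, hc.add_pow, Finset.sum_range_succ, Finset.sum_range_succ, Finset.sum_eq_zero]
      · rw [Nat.choose_succ_self_right, Nat.sub_self, Nat.add_sub_cancel_left, ih.1, ih.2, zero_mul,
          zero_mul, add_zero, zero_add, pow_one, smul_mul_assoc,
          Algebra.TensorProduct.tmul_mul_tmul, ← nsmul_eq_mul', ← Nat.cast_smul_eq_nsmul ℂ,
          smul_smul, Nat.factorial_succ, Nat.cast_mul]
        rfl
      · intro i hi
        obtain ⟨n, hn⟩ : ∃ n, k + 1 - i = n + 2 :=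
          ⟨k + 1 - i - 2, by have := Finset.mem_range.1 hi; omega⟩
        rw [hn, pow_add _ n 2, hz, mul_zero, mul_zero, zero_mul]
    refine ⟨?_, hk⟩
    rw [pow_succ, hk, hs, smul_mul_assoc, mul_add]
    have h1 : (thetaProd (k + 1) ⊗ₜ[ℂ] thetaProd (k + 1)) * thetaSum k = 0 := by
      have h2 : (k.factorial : ℂ) • ((thetaProd (k + 1) ⊗ₜ[ℂ] thetaProd (k + 1)) * thetaSum k) =
          0 := by
        have h3 : thetaProd (k + 1) ⊗ₜ[ℂ] thetaProd (k + 1) =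
            (thetaProd k ⊗ₜ[ℂ] thetaProd k) * (oddGen Empty k ⊗ₜ[ℂ] oddGen Empty k) := by
          rw [Algebra.TensorProduct.tmul_mul_tmul]
          rfl
        rw [h3, mul_assoc, ← hc.eq, ← mul_assoc, ← smul_mul_assoc, ← smul_mul_assoc, ← ih.2,
          ← pow_succ, ih.1, zero_mul]
      exact (smul_eq_zero.1 h2).resolve_left (by exact_mod_cast k.factorial_ne_zero)
    rw [h1, Algebra.TensorProduct.tmul_mul_tmul]
    simp [thetaProd, mul_assoc, oddGen_mul_self]

/-- The powers of a nilpotent element up to the last nonzero one are linearly independent. -/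
theorem exists_functional_pow {Q : Type*} [Ring Q] [Algebra ℂ Q] {u : Q} {k : ℕ}
    (h0 : u ^ (k + 1) = 0) (h1 : u ^ k ≠ 0) : ∃ φ : Q →ₗ[ℂ] ℂ, ∀ i ≤ k, φ (u ^ i) = 1 := by
  have hli : LinearIndependent ℂ fun i : Fin (k + 1) => u ^ (i : ℕ) := by
    rw [Fintype.linearIndependent_iff]
    intro g hg
    have key : ∀ i (hi : i < k + 1), g ⟨i, hi⟩ = 0 := by
      intro i
      induction i using Nat.strong_induction_on with
      | _ i ih =>
        intro hi
        -- Multiplication by `u ^ (k - i)` kills the powers beyond `u ^ i`.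
        have h2 := congrArg (fun x => x * u ^ (k - i)) hg
        simp only [zero_mul, Finset.sum_mul, smul_mul_assoc, ← pow_add] at h2
        rw [Finset.sum_eq_single ⟨i, hi⟩] at h2
        · rw [Nat.add_sub_cancel' (Nat.lt_succ_iff.1 hi)] at h2
          exact (smul_eq_zero.1 h2).resolve_right h1
        · intro l _ hl
          rcases lt_or_gt_of_ne (fun h => hl (Fin.ext h) : (l : ℕ) ≠ i) with h | h
          · rw [ih l h l.2, zero_smul]
          · obtain ⟨m, hm⟩ : ∃ m, (l : ℕ) + (k - i) = k + 1 + m :=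
              ⟨(l : ℕ) + (k - i) - (k + 1), by omega⟩
            rw [hm, pow_add, h0, zero_mul, smul_zero]
        · simp
    exact fun i => key i i.2
  obtain ⟨G, hG⟩ := LinearMap.exists_leftInverse_of_injective
    (Fintype.linearCombination ℂ fun i : Fin (k + 1) => u ^ (i : ℕ))
    (LinearMap.ker_eq_bot.2 (linearIndependent_iff_injective_fintypeLinearCombination.1 hli))
  refine ⟨(Fintype.linearCombination ℂ fun _ => (1 : ℂ)) ∘ₗ G, fun i hi => ?_⟩
  have h := LinearMap.congr_fun hG (Pi.single ⟨i, Nat.lt_succ_of_le hi⟩ 1)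
  rw [LinearMap.comp_apply, Fintype.linearCombination_apply_single, one_smul] at h
  rw [LinearMap.comp_apply, h]
  simp

/-- Evaluation at `T = 1` of an element of `M ⊗ ℂ[T]` is a contraction of its value at
`T = ∑ p < k, θ_p ⊗ θ_p`, if `k` is large. -/
theorem exists_contract_thetaSum {M : Type*} [AddCommGroup M] [Module ℂ M]
    (w : M ⊗[ℂ] Polynomial ℂ) : ∃ k, ∃ φ : Theta ⊗[ℂ] Theta →ₗ[ℂ] ℂ,
      contract M φ ((Polynomial.aeval (thetaSum k)).toLinearMap.lTensor M w) =
        contract M (Polynomial.aeval (1 : ℂ)).toLinearMap w := by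
  have h : ∃ k₀, ∀ k ≥ k₀, ∀ φ : Theta ⊗[ℂ] Theta →ₗ[ℂ] ℂ, (∀ i ≤ k, φ (thetaSum k ^ i) = 1) →
      contract M φ ((Polynomial.aeval (thetaSum k)).toLinearMap.lTensor M w) =
        contract M (Polynomial.aeval (1 : ℂ)).toLinearMap w := by
    induction w using TensorProduct.induction_on with
    | zero => exact ⟨0, fun k _ φ _ => by simp⟩
    | tmul m p =>
      refine ⟨p.natDegree, fun k hk φ hφ => ?_⟩
      rw [LinearMap.lTensor_tmul, contract_tmul, contract_tmul]
      congr 1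
      simp only [AlgHom.toLinearMap_apply, Polynomial.aeval_eq_sum_range, map_sum, map_smul,
        one_pow]
      refine Finset.sum_congr rfl fun i hi => ?_
      rw [hφ i ((Nat.lt_succ_iff.1 (Finset.mem_range.1 hi)).trans hk)]
    | add x y hx hy =>
      obtain ⟨k₁, h₁⟩ := hx
      obtain ⟨k₂, h₂⟩ := hy
      refine ⟨max k₁ k₂, fun k hk φ hφ => ?_⟩
      rw [map_add, map_add, map_add, h₁ k (le_of_max_le_left hk) φ hφ,
        h₂ k (le_of_max_le_right hk) φ hφ]
  obtain ⟨k, hk⟩ := h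
  obtain ⟨φ, hφ⟩ := exists_functional_pow (thetaSum_pow k).1 (by
    rw [(thetaSum_pow k).2]
    refine smul_ne_zero (by exact_mod_cast k.factorial_ne_zero) ?_
    intro h
    have h2 : ∀ f : Module.Dual ℂ Theta, f (thetaProd k) = 0 := fun f => by
      have h3 := congrArg (contract Theta f) h
      rw [contract_tmul, map_zero] at h3
      exact (smul_eq_zero.1 h3).resolve_right (thetaProd_ne_zero k)
    exact thetaProd_ne_zero k ((Module.forall_dual_apply_eq_zero_iff ℂ _).1 h2))
  exact ⟨k, φ, hk k le_rfl φ hφ⟩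

/-! ### Polarization and restitution -/

section Polarize

variable {σ ν E : Type*} [CommRing E] [Algebra ℂ E] {k : ℕ}

/-- The homomorphism `x_s ↦ a_s`, `y_n ↦ ∑ p, y_{p,n} θ_p`, whose coefficient of `θ_0 ⋯ θ_{k-1}` is
the full polarization of an element of degree `k` in the odd variables. -/
def polarize (a : σ → E) (y : Fin k → ν → E) : SuperPoly σ ν →ₐ[ℂ] E ⊗[ℂ] Theta :=
  superLift (fun s => a s ⊗ₜ 1)
    (fun s => ((isSuperComm_parity Empty ℕ).tensor_left E).mem_center (by simp))
    (fun n => ∑ p, y p n ⊗ₜ oddGen Empty (p : ℕ))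
    (((isSuperComm_parity Empty ℕ).tensor_left E).mul_self_linearCombination fun n => by
      simp only [map_sum, Algebra.TensorProduct.map_tmul, AlgHom.id_apply,
        parity_oddGen, TensorProduct.tmul_neg,
        Finset.sum_neg_distrib])

@[simp]
theorem polarize_evenGen (a : σ → E) (y : Fin k → ν → E) (s : σ) :
    polarize a y (evenGen ν s) = a s ⊗ₜ 1 := superLift_evenGen _ _ _ _ s

@[simp]
theorem polarize_oddGen (a : σ → E) (y : Fin k → ν → E) (n : ν) :
    polarize a y (oddGen σ n) = ∑ p, y p n ⊗ₜ oddGen Empty (p : ℕ) := superLift_oddGen _ _ _ _ n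

end Polarize

theorem exists_aeval_of_commute {σ T : Type*} [Ring T] [Algebra ℂ T] (t : σ → T)
    (ht : ∀ i j, t i * t j = t j * t i) :
    ∃ f : MvPolynomial σ ℂ →ₐ[ℂ] T, ∀ i, f (MvPolynomial.X i) = t i := by
  have hS : IsMulCommutative (Algebra.adjoin ℂ (Set.range t)) :=
    Algebra.isMulCommutative_adjoin ℂ (by
      rintro _ ⟨i, rfl⟩ _ ⟨j, rfl⟩
      exact ht i j)
  let i₁ : CommRing (Algebra.adjoin ℂ (Set.range t)) :=
    { (Algebra.adjoin ℂ (Set.range t)).toRing with mul_comm := hS.is_comm.comm }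
  let f : MvPolynomial σ ℂ →ₐ[ℂ] Algebra.adjoin ℂ (Set.range t) :=
    MvPolynomial.aeval fun i => ⟨t i, Algebra.subset_adjoin ⟨i, rfl⟩⟩
  exact ⟨(Algebra.adjoin ℂ (Set.range t)).val.comp f, fun i =>
    congrArg Subtype.val (MvPolynomial.aeval_X _ i)⟩

section Restitute

variable (ι κ : Type*) (k : ℕ)

theorem exists_restitute :
    ∃ f : MvPolynomial (ι ⊕ Fin k × κ) ℂ →ₐ[ℂ] SuperPoly ι κ ⊗[ℂ] Theta,
      ∀ s, f (MvPolynomial.X s) = Sum.elim (fun i => evenGen κ i ⊗ₜ[ℂ] (1 : Theta))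
        (fun q => oddGen ι q.2 ⊗ₜ[ℂ] oddGen Empty (q.1 : ℕ)) s := by
  have h : ∀ s, Algebra.TensorProduct.map (parity ι κ) (parity Empty ℕ)
      (Sum.elim (fun i => evenGen κ i ⊗ₜ[ℂ] (1 : Theta))
        (fun q : Fin k × κ => oddGen ι q.2 ⊗ₜ[ℂ] oddGen Empty (q.1 : ℕ)) s) =
      Sum.elim (fun i => evenGen κ i ⊗ₜ[ℂ] (1 : Theta))
        (fun q => oddGen ι q.2 ⊗ₜ[ℂ] oddGen Empty (q.1 : ℕ)) s := by
    rintro (i | q)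
    · simp only [Sum.elim_inl, Algebra.TensorProduct.map_tmul, map_one,
        parity_evenGen]
    · simp only [Sum.elim_inr, Algebra.TensorProduct.map_tmul,
        parity_oddGen, TensorProduct.tmul_neg, TensorProduct.neg_tmul,
        neg_neg]
  exact exists_aeval_of_commute _ fun s s' =>
    (isSuperComm_parity ι κ).commute_tensor (isSuperComm_parity Empty ℕ) (h s) (h s')

/-- The restitution homomorphism `x_i ↦ x_i`, `y_{p,n} ↦ y_n θ_p`. -/
def restitute : MvPolynomial (ι ⊕ Fin k × κ) ℂ →ₐ[ℂ] SuperPoly ι κ ⊗[ℂ] Theta :=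
  (exists_restitute ι κ k).choose

variable {ι κ k}

@[simp]
theorem restitute_X_inl (i : ι) :
    restitute ι κ k (MvPolynomial.X (Sum.inl i)) = evenGen κ i ⊗ₜ 1 :=
  (exists_restitute ι κ k).choose_spec _

@[simp]
theorem restitute_X_inr (q : Fin k × κ) :
    restitute ι κ k (MvPolynomial.X (Sum.inr q)) =
      oddGen ι q.2 ⊗ₜ oddGen Empty (q.1 : ℕ) :=
  (exists_restitute ι κ k).choose_spec _

theorem parity_restitute (r : MvPolynomial (ι ⊕ Fin k × κ) ℂ) :
    Algebra.TensorProduct.map (parity ι κ) (parity Empty ℕ) (restitute ι κ k r) =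
      restitute ι κ k r := by
  suffices h : (Algebra.TensorProduct.map (parity ι κ) (parity Empty ℕ)).comp
      (restitute ι κ k) = restitute ι κ k from DFunLike.congr_fun h r
  refine MvPolynomial.algHom_ext ?_
  rintro (i | q)
  · simp [parity_evenGen]
  · simp [parity_oddGen, TensorProduct.tmul_neg, TensorProduct.neg_tmul]

variable (ι κ k) in
theorem exists_arcRestitute :
    ∃ Φ : ArcAlg (MvPolynomial (ι ⊕ Fin k × κ) ℂ) →ₐ[ℂ] SuperPoly (ι × ℕ) (κ × ℕ) ⊗[ℂ] Theta,
      ∀ r j, Φ (arcCoeff r j) = (superArc ι κ j).rTensor Theta (restitute ι κ k r) := by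
  have hp : ∀ j z, Algebra.TensorProduct.map (parity _ _) (parity Empty ℕ)
      ((superArc ι κ j).rTensor Theta z) = (superArc ι κ j).rTensor Theta
        (Algebra.TensorProduct.map (parity _ _) (parity Empty ℕ) z) := by
    intro j z
    induction z using TensorProduct.induction_on with
    | zero => simp
    | tmul b t => simp [parity_superArc]
    | add x y hx hy => simp only [map_add, hx, hy]
  exact (((isArc_superArc ι κ).rTensor Theta).precomp (restitute ι κ k)).exists_lift
    fun i j r s => (isSuperComm_parity _ _).commute_tensor (isSuperComm_parity Empty ℕ)
      ((hp _ _).trans (congrArg _ (parity_restitute r)))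
      ((hp _ _).trans (congrArg _ (parity_restitute s)))

end Restitute

section Scale

variable (σ ν : Type*)

/-- The homomorphism `x ↦ x`, `y ↦ T y`, whose coefficient of `T ^ d` is the projection to the
elements of degree `d` in the odd variables. -/
def scale : SuperPoly σ ν →ₐ[ℂ] SuperPoly σ ν ⊗[ℂ] Polynomial ℂ :=
  superLift (fun s => evenGen ν s ⊗ₜ 1)
    (fun s => ((isSuperComm_parity σ ν).tensor_right (Polynomial ℂ)).mem_center (by
      simp [parity_evenGen]))
    (fun n => oddGen σ n ⊗ₜ Polynomial.X)
    (((isSuperComm_parity σ ν).tensor_right (Polynomial ℂ)).mul_self_linearCombination fun n => by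
      simp [parity_oddGen, TensorProduct.neg_tmul])

variable {σ ν}

@[simp]
theorem scale_evenGen (s : σ) : scale σ ν (evenGen ν s) = evenGen ν s ⊗ₜ 1 :=
  superLift_evenGen _ _ _ _ s

@[simp]
theorem scale_oddGen (n : ν) : scale σ ν (oddGen σ n) = oddGen σ n ⊗ₜ Polynomial.X :=
  superLift_oddGen _ _ _ _ n

end Scale

theorem contract_aeval_eq {A : Type*} [Ring A] [Algebra ℂ A] (c : ℂ) (z : A ⊗[ℂ] Polynomial ℂ) :
    contract A (Polynomial.aeval c).toLinearMap z =
      (Algebra.TensorProduct.rid ℂ ℂ A).toAlgHom.comp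
        (Algebra.TensorProduct.map (AlgHom.id ℂ A) (Polynomial.aeval c)) z := by
  induction z using TensorProduct.induction_on with
  | zero => simp
  | tmul a p => simp
  | add x y hx hy => simp only [map_add, hx, hy]

theorem contract_scale {σ ν : Type*} (b : SuperPoly σ ν) :
    contract _ (Polynomial.aeval (1 : ℂ)).toLinearMap (scale σ ν b) = b := by
  rw [contract_aeval_eq]
  suffices h : ((Algebra.TensorProduct.rid ℂ ℂ (SuperPoly σ ν)).toAlgHom.comp
        (Algebra.TensorProduct.map (AlgHom.id ℂ _) (Polynomial.aeval 1))).comp (scale σ ν) =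
      AlgHom.id ℂ _ from DFunLike.congr_fun h b
  refine superPoly_hom_ext (fun s => ?_) fun n => ?_ <;> simp

section Universal

variable (ι κ : Type*) (k : ℕ)

/-- The polarization homomorphism to the functions on the sum of one copy of the first module
and `k` copies of the second. -/
def polarizeFun : SuperPoly ι κ →ₐ[ℂ] MvPolynomial (ι ⊕ Fin k × κ) ℂ ⊗[ℂ] Theta :=
  polarize (fun i => MvPolynomial.X (Sum.inl i)) (fun p n => MvPolynomial.X (Sum.inr (p, n)))

/-- The polarization homomorphism on arcs. -/
def polarizeArc : SuperPoly (ι × ℕ) (κ × ℕ) →ₐ[ℂ]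
    ArcAlg (MvPolynomial (ι ⊕ Fin k × κ) ℂ) ⊗[ℂ] Theta :=
  polarize (fun s => arcCoeff (MvPolynomial.X (Sum.inl s.1)) s.2)
    (fun p n => arcCoeff (MvPolynomial.X (Sum.inr (p, n.1))) n.2)

variable {ι κ k}

theorem polarizeArc_superArc (j : ℕ) (b : SuperPoly ι κ) :
    polarizeArc ι κ k (superArc ι κ j b) =
      (arcFam (MvPolynomial (ι ⊕ Fin k × κ) ℂ) j).rTensor Theta (polarizeFun ι κ k b) := by
  exact IsArc.superPoly_ext ((isArc_superArc ι κ).comp (polarizeArc ι κ k))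
    (((isArc_arcFam _).rTensor Theta).precomp (polarizeFun ι κ k))
    (fun j s => by simp [polarizeArc, polarizeFun])
    (fun j n => by simp [polarizeArc, polarizeFun]) j b

/-- Polarization followed by restitution multiplies the odd variables by `∑ p, θ_p ⊗ θ_p`. -/
theorem restitute_polarizeFun (b : SuperPoly ι κ) :
    Algebra.TensorProduct.assoc ℂ ℂ ℂ _ _ _ (Algebra.TensorProduct.map (restitute ι κ k)
        (AlgHom.id ℂ Theta) (polarizeFun ι κ k b)) =
      Algebra.TensorProduct.map (AlgHom.id ℂ _) (Polynomial.aeval (thetaSum k))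
        (scale ι κ b) := by
  suffices h : ((Algebra.TensorProduct.assoc ℂ ℂ ℂ _ _ _).toAlgHom.comp
      (Algebra.TensorProduct.map (restitute ι κ k) (AlgHom.id ℂ Theta))).comp
        (polarizeFun ι κ k) =
      (Algebra.TensorProduct.map (AlgHom.id ℂ _) (Polynomial.aeval (thetaSum k))).comp
        (scale ι κ) from DFunLike.congr_fun h b
  refine superPoly_hom_ext (fun s => ?_) fun n => ?_
  · simp [polarizeFun, Algebra.TensorProduct.one_def]
  · simp [polarizeFun, thetaSum, TensorProduct.tmul_sum, Finset.sum_range]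

theorem arcRestitute_polarizeArc {Φ : ArcAlg (MvPolynomial (ι ⊕ Fin k × κ) ℂ) →ₐ[ℂ]
      SuperPoly (ι × ℕ) (κ × ℕ) ⊗[ℂ] Theta}
    (hΦ : ∀ r j, Φ (arcCoeff r j) = (superArc ι κ j).rTensor Theta (restitute ι κ k r))
    (b : SuperPoly (ι × ℕ) (κ × ℕ)) :
    Algebra.TensorProduct.assoc ℂ ℂ ℂ _ _ _ (Algebra.TensorProduct.map Φ
        (AlgHom.id ℂ Theta) (polarizeArc ι κ k b)) =
      Algebra.TensorProduct.map (AlgHom.id ℂ _) (Polynomial.aeval (thetaSum k))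
        (scale (ι × ℕ) (κ × ℕ) b) := by
  suffices h : ((Algebra.TensorProduct.assoc ℂ ℂ ℂ _ _ _).toAlgHom.comp
      (Algebra.TensorProduct.map Φ (AlgHom.id ℂ Theta))).comp (polarizeArc ι κ k) =
      (Algebra.TensorProduct.map (AlgHom.id ℂ _) (Polynomial.aeval (thetaSum k))).comp
        (scale (ι × ℕ) (κ × ℕ)) from DFunLike.congr_fun h b
  refine superPoly_hom_ext (fun s => ?_) fun n => ?_
  · simp [polarizeArc, hΦ, Algebra.TensorProduct.one_def]
  · simp [polarizeArc, hΦ, thetaSum, TensorProduct.tmul_sum, Finset.sum_range]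

end Universal

/-! ### Equivariance -/

section Equivariance

variable {O σ ν : Type*} [CommRing O] [Algebra ℂ O]

theorem superCoaction_evenGen (c₀ : σ → σ →₀ O) (c₁ : ν → ν →₀ O) (s : σ) :
    superCoaction c₀ c₁ (evenGen ν s) = (c₀ s).sum fun s' o => o ⊗ₜ[ℂ] evenGen ν s' :=
  superLift_evenGen _ _ _ _ s

theorem superCoaction_oddGen (c₀ : σ → σ →₀ O) (c₁ : ν → ν →₀ O) (n : ν) :
    superCoaction c₀ c₁ (oddGen σ n) = (c₁ n).sum fun n' o => o ⊗ₜ[ℂ] oddGen σ n' :=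
  superLift_oddGen _ _ _ _ n

variable {ι κ H : Type*} [Fintype ι] [Fintype κ] [CommRing H] [Algebra ℂ H]
  (a : Matrix ι ι H) (b : Matrix κ κ H) (k : ℕ)

theorem classicalRow_sum {M : Type*} [AddCommGroup M] [Module ℂ M] (i : ι) (g : ι → M) :
    ((classicalRow a i).sum fun i' o => o ⊗ₜ[ℂ] g i') = ∑ i', a i i' ⊗ₜ[ℂ] g i' := by
  rw [classicalRow, ← Finsupp.sum_finsetSum_index]
  · exact Finset.sum_congr rfl fun k _ => Finsupp.sum_single_index (TensorProduct.zero_tmul _ _)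
  · exact fun _ => TensorProduct.zero_tmul _ _
  · exact fun _ _ _ => TensorProduct.add_tmul _ _ _

theorem arcRow_sum {M : Type*} [AddCommGroup M] [Module ℂ M] (s : ι × ℕ) (g : ι × ℕ → M) :
    ((arcRow a s).sum fun i' o => o ⊗ₜ[ℂ] g i') =
      ∑ q ∈ antidiagonal s.2, ∑ i', arcCoeff (a s.1 i') q.1 ⊗ₜ[ℂ] g (i', q.2) := by
  rw [arcRow, ← Finsupp.sum_finsetSum_index]
  · refine Finset.sum_congr rfl fun q _ => ?_
    rw [← Finsupp.sum_finsetSum_index]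
    · exact Finset.sum_congr rfl fun k _ => Finsupp.sum_single_index (TensorProduct.zero_tmul _ _)
    · exact fun _ => TensorProduct.zero_tmul _ _
    · exact fun _ _ _ => TensorProduct.add_tmul _ _ _
  · exact fun _ => TensorProduct.zero_tmul _ _
  · exact fun _ _ _ => TensorProduct.add_tmul _ _ _

theorem classicalCoaction_evenGen (i : ι) :
    classicalCoaction a b (evenGen κ i) = ∑ i', a i i' ⊗ₜ evenGen κ i' :=
  (superCoaction_evenGen _ _ i).trans (classicalRow_sum a i _)

theorem classicalCoaction_oddGen (n : κ) :
    classicalCoaction a b (oddGen ι n) = ∑ n', b n n' ⊗ₜ oddGen ι n' :=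
  (superCoaction_oddGen _ _ n).trans (classicalRow_sum b n _)

theorem arcSuperCoaction_evenGen (s : ι × ℕ) :
    arcSuperCoaction a b (evenGen (κ × ℕ) s) =
      ∑ q ∈ antidiagonal s.2, ∑ i', arcCoeff (a s.1 i') q.1 ⊗ₜ evenGen (κ × ℕ) (i', q.2) :=
  (superCoaction_evenGen _ _ s).trans (arcRow_sum a s _)

theorem arcSuperCoaction_oddGen (n : κ × ℕ) :
    arcSuperCoaction a b (oddGen (ι × ℕ) n) =
      ∑ q ∈ antidiagonal n.2, ∑ n', arcCoeff (b n.1 n') q.1 ⊗ₜ oddGen (ι × ℕ) (n', q.2) :=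
  (superCoaction_oddGen _ _ n).trans (arcRow_sum b n _)

theorem polyCoaction_sumMat_inl (i : ι) :
    polyCoaction (sumMat a b k) (MvPolynomial.X (Sum.inl i)) =
      ∑ i', a i i' ⊗ₜ MvPolynomial.X (Sum.inl i') := by
  simp [polyCoaction, sumMat]

theorem polyCoaction_sumMat_inr (p : Fin k) (n : κ) :
    polyCoaction (sumMat a b k) (MvPolynomial.X (Sum.inr (p, n))) =
      ∑ n', b n n' ⊗ₜ MvPolynomial.X (Sum.inr (p, n')) := by
  simp [polyCoaction, sumMat, Fintype.sum_prod_type, TensorProduct.ite_tmul]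

theorem arcCoaction_arcCoeff {R : Type*} [CommRing R] [Algebra ℂ R] (c : R →ₐ[ℂ] H ⊗[ℂ] R)
    {τ : Type*} [Fintype τ] (r : R) (f : τ → H) (g : τ → R) (h : c r = ∑ t, f t ⊗ₜ g t) (j : ℕ) :
    arcCoaction c (arcCoeff r j) =
      ∑ q ∈ antidiagonal j, ∑ t, arcCoeff (f t) q.1 ⊗ₜ arcCoeff (g t) q.2 := by
  rw [Finset.sum_comm]
  simp [arcCoaction, h, PowerSeries.coeff_mul, PowerSeries.mapAlgHom_apply]

theorem polarizeFun_equivariant :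
    ((Algebra.TensorProduct.assoc ℂ ℂ ℂ H _ Theta).toAlgHom.comp
      (Algebra.TensorProduct.map (polyCoaction (sumMat a b k)) (AlgHom.id ℂ Theta))).comp
        (polarizeFun ι κ k) =
      (Algebra.TensorProduct.map (AlgHom.id ℂ H) (polarizeFun ι κ k)).comp
        (classicalCoaction a b) := by
  refine superPoly_hom_ext (fun i => ?_) fun n => ?_
  · simp [polarizeFun, classicalCoaction_evenGen, polyCoaction_sumMat_inl, TensorProduct.sum_tmul]
  · simp [polarizeFun, classicalCoaction_oddGen, polyCoaction_sumMat_inr, TensorProduct.sum_tmul,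
      TensorProduct.tmul_sum]
    exact Finset.sum_comm

theorem polarizeArc_equivariant :
    ((Algebra.TensorProduct.assoc ℂ ℂ ℂ (ArcAlg H) _ Theta).toAlgHom.comp
      (Algebra.TensorProduct.map (arcCoaction (polyCoaction (sumMat a b k)))
        (AlgHom.id ℂ Theta))).comp (polarizeArc ι κ k) =
      (Algebra.TensorProduct.map (AlgHom.id ℂ (ArcAlg H)) (polarizeArc ι κ k)).comp
        (arcSuperCoaction a b) := by
  refine superPoly_hom_ext (fun s => ?_) fun n => ?_
  · simp [polarizeArc, arcSuperCoaction_evenGen, TensorProduct.sum_tmul,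
      arcCoaction_arcCoeff _ _ _ _ (polyCoaction_sumMat_inl a b k _)]
  · simp [polarizeArc, arcSuperCoaction_oddGen, TensorProduct.sum_tmul, TensorProduct.tmul_sum,
      arcCoaction_arcCoeff _ _ _ _ (polyCoaction_sumMat_inr a b k _ _)]
    rw [Finset.sum_comm]
    exact Finset.sum_congr rfl fun q _ => Finset.sum_comm

theorem restitute_equivariant :
    ((Algebra.TensorProduct.assoc ℂ ℂ ℂ H _ Theta).toAlgHom.comp
      (Algebra.TensorProduct.map (classicalCoaction a b) (AlgHom.id ℂ Theta))).comp
        (restitute ι κ k) =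
      (Algebra.TensorProduct.map (AlgHom.id ℂ H) (restitute ι κ k)).comp
        (polyCoaction (sumMat a b k)) := by
  refine MvPolynomial.algHom_ext ?_
  rintro (i | ⟨p, n⟩)
  · simp [classicalCoaction_evenGen, polyCoaction_sumMat_inl, TensorProduct.sum_tmul]
  · simp [classicalCoaction_oddGen, polyCoaction_sumMat_inr, TensorProduct.sum_tmul]

theorem scale_equivariant :
    ((Algebra.TensorProduct.assoc ℂ ℂ ℂ H _ (Polynomial ℂ)).toAlgHom.comp
      (Algebra.TensorProduct.map (classicalCoaction a b) (AlgHom.id ℂ (Polynomial ℂ)))).comp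
        (scale ι κ) =
      (Algebra.TensorProduct.map (AlgHom.id ℂ H) (scale ι κ)).comp (classicalCoaction a b) := by
  refine superPoly_hom_ext (fun i => ?_) fun n => ?_
  · simp [classicalCoaction_evenGen, TensorProduct.sum_tmul]
  · simp [classicalCoaction_oddGen, TensorProduct.sum_tmul]

end Equivariance

/-! ### Invariants of the arc group -/

theorem arcAlg_hom_mem {R T : Type*} [CommRing R] [Algebra ℂ R] [Ring T] [Algebra ℂ T]
    {f : ArcAlg R →ₐ[ℂ] T} {S : Subalgebra ℂ T} (h : ∀ r j, f (arcCoeff r j) ∈ S)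
    (x : ArcAlg R) : f x ∈ S := by
  obtain ⟨p, rfl⟩ : ∃ p, arcMk R p = x := Ideal.Quotient.mk_surjective x
  induction p using MvPolynomial.induction_on with
  | C c =>
    have h2 : arcMk R (MvPolynomial.C c) = algebraMap ℂ _ c := AlgHom.commutes (arcMk R) c
    rw [h2, AlgHom.commutes]
    exact S.algebraMap_mem c
  | add p q hp hq => rw [map_add, map_add]; exact add_mem hp hq
  | mul_X p i hp => rw [map_mul, map_mul]; exact mul_mem hp (h i.1 i.2)

section DiffAdjoin

variable {B : Type*} [Ring B] [Algebra ℂ B] {D : B →ₗ[ℂ] B} {s : Set B}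

theorem subset_diffAdjoin : s ⊆ diffAdjoin D s := fun _ hx =>
  Algebra.mem_sInf.2 fun _ hA => hA.1 hx

theorem diffAdjoin_stable {x : B} (hx : x ∈ diffAdjoin D s) : D x ∈ diffAdjoin D s :=
  Algebra.mem_sInf.2 fun A hA => hA.2 x (Algebra.mem_sInf.1 hx A hA)

theorem diffAdjoin_le {A : Subalgebra ℂ B} (h : s ⊆ A) (hD : ∀ a ∈ A, D a ∈ A) :
    diffAdjoin D s ≤ A := sInf_le ⟨h, hD⟩

end DiffAdjoin

section Invariants

variable {ι κ H : Type*} [Fintype ι] [Fintype κ] [CommRing H] [Algebra ℂ H]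
  (a : Matrix ι ι H) (b : Matrix κ κ H)

/-- The invariants are stable under `D`, because the coaction intertwines `D` with the derivation
`D ⊗ 1 + 1 ⊗ D` and `D` vanishes on constant functions on the arc group. -/
theorem superD_mem_coinvariants {x : SuperPoly (ι × ℕ) (κ × ℕ)}
    (hx : x ∈ coinvariants (arcSuperCoaction a b)) :
    superD ι κ x ∈ coinvariants (arcSuperCoaction a b) := by
  obtain ⟨d, hd, hd'⟩ := exists_arcDer H
  have hd1 : d 1 = 0 := by
    have h := hd 1 1
    rw [mul_one, mul_one, one_mul] at h
    exact left_eq_add.1 h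
  let D' : ArcAlg H ⊗[ℂ] SuperPoly (ι × ℕ) (κ × ℕ) →ₗ[ℂ]
      ArcAlg H ⊗[ℂ] SuperPoly (ι × ℕ) (κ × ℕ) :=
    d.rTensor (SuperPoly (ι × ℕ) (κ × ℕ)) + (superD ι κ).lTensor (ArcAlg H)
  have hD : ∀ o z, D' (o ⊗ₜ z) = d o ⊗ₜ z + o ⊗ₜ superD ι κ z := fun o z => by simp [D']
  have hD' : ∀ z w, D' (z * w) = z * D' w + D' z * w := by
    intro z w
    induction z using TensorProduct.induction_on with
    | zero => simp
    | add x y hx hy => simp only [add_mul, map_add, hx, hy]; abel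
    | tmul o x =>
      induction w using TensorProduct.induction_on with
      | zero => simp
      | add x y hx hy => simp only [mul_add, map_add, hx, hy]; abel
      | tmul p y =>
        simp only [hD, hd, superD_mul, Algebra.TensorProduct.tmul_mul_tmul, mul_add, add_mul,
          TensorProduct.add_tmul, TensorProduct.tmul_add]
        abel
  have key : ∀ z, arcSuperCoaction a b (superD ι κ z) = D' (arcSuperCoaction a b z) := by
    intro z
    induction z using superPoly_induction_gen with
    | hc c =>
      rw [superD_algebraMap, map_zero, AlgHom.commutes, Algebra.algebraMap_eq_smul_one,
        Algebra.TensorProduct.one_def, map_smul, hD, hd1, ← map_one (algebraMap ℂ _),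
        superD_algebraMap]
      simp
    | heven s =>
      obtain ⟨i, j⟩ := s
      rw [superD_evenGen, map_smul, arcSuperCoaction_evenGen, arcSuperCoaction_evenGen]
      simp only [map_sum, hD, hd', superD_evenGen]
      rw [← sum_antidiagonal_deriv fun p q =>
        ∑ i', arcCoeff (a i i') p ⊗ₜ[ℂ] evenGen (κ × ℕ) (i', q)]
      simp only [Finset.smul_sum, ← Finset.sum_add_distrib, TensorProduct.tmul_smul,
        TensorProduct.smul_tmul']
    | hodd n =>
      obtain ⟨n, j⟩ := n
      rw [superD_oddGen, map_smul, arcSuperCoaction_oddGen, arcSuperCoaction_oddGen]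
      simp only [map_sum, hD, hd', superD_oddGen]
      rw [← sum_antidiagonal_deriv fun p q =>
        ∑ n', arcCoeff (b n n') p ⊗ₜ[ℂ] oddGen (ι × ℕ) (n', q)]
      simp only [Finset.smul_sum, ← Finset.sum_add_distrib, TensorProduct.tmul_smul,
        TensorProduct.smul_tmul']
    | hmul x y hx hy => rw [superD_mul, map_add, map_mul, map_mul, map_mul, hD', hx, hy]
    | hadd x y hx hy => rw [map_add, map_add, map_add, map_add, hx, hy]
  have h : arcSuperCoaction a b x = 1 ⊗ₜ x := hx
  change arcSuperCoaction a b (superD ι κ x) = 1 ⊗ₜ superD ι κ x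
  rw [key, h, hD, hd1, TensorProduct.zero_tmul, zero_add]

theorem levelZero_mem_coinvariants {x : SuperPoly ι κ}
    (hx : x ∈ coinvariants (classicalCoaction a b)) :
    levelZero ι κ x ∈ coinvariants (arcSuperCoaction a b) := by
  -- The coaction at level zero factors through the constant terms of arcs of the group.
  let e : H →ₐ[ℂ] ArcAlg H := AlgHom.ofLinearMap (arcFam H 0)
    (by simpa using (isArc_arcFam H).one 0) fun r s => by simpa using (isArc_arcFam H).mul r s 0
  have he : ∀ r, e r = arcCoeff r 0 := arcFam_apply H 0
  have h : (arcSuperCoaction a b).comp (levelZero ι κ) =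
      (Algebra.TensorProduct.map e (levelZero ι κ)).comp (classicalCoaction a b) := by
    refine superPoly_hom_ext (fun i => ?_) fun n => ?_
    · simp [levelZero_evenGen, arcSuperCoaction_evenGen, classicalCoaction_evenGen, he]
    · simp [levelZero_oddGen, arcSuperCoaction_oddGen, classicalCoaction_oddGen, he]
  have h2 : classicalCoaction a b x = 1 ⊗ₜ x := hx
  have h3 := DFunLike.congr_fun h x
  rw [AlgHom.comp_apply, AlgHom.comp_apply, h2, Algebra.TensorProduct.map_tmul, map_one] at h3
  exact h3

theorem superArc_mem_diffAdjoin {ι κ : Type*} {s : Set (SuperPoly ι κ)} {x : SuperPoly ι κ}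
    (hx : x ∈ s) (j : ℕ) : superArc ι κ j x ∈ diffAdjoin (superD ι κ) (levelZero ι κ '' s) :=
  divPow_mem (S := Subalgebra.toSubmodule (diffAdjoin (superD ι κ) (levelZero ι κ '' s)))
    (fun _ h => diffAdjoin_stable h) (subset_diffAdjoin ⟨x, hx, rfl⟩) j

/-- Polarize an invariant, write it as a polynomial in the `r⁽ʲ⁾` for invariants `r` of `Ũ ⊕ U^k`,
and recover it by restitution. -/
theorem coinvariants_le_diffAdjoin
    (hsurj : ∀ k : ℕ, Function.Surjective (arcQuotientMap (polyCoaction (sumMat a b k)))) :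
    coinvariants (arcSuperCoaction a b) ≤
      diffAdjoin (superD ι κ) (levelZero ι κ '' coinvariants (classicalCoaction a b)) := by
  intro x hx
  obtain ⟨k, φ, hφ⟩ := exists_contract_thetaSum (scale (ι × ℕ) (κ × ℕ) x)
  obtain ⟨Φ, hΦ⟩ := exists_arcRestitute ι κ k
  obtain ⟨f, hf⟩ := exists_coinvariants_restrict _ _ _ (polarizeArc_equivariant a b k)
  obtain ⟨g, hg⟩ := exists_coinvariants_restrict _ _ _ (restitute_equivariant a b k)
  set A := diffAdjoin (superD ι κ) (levelZero ι κ '' coinvariants (classicalCoaction a b))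
  have hΦA : ∀ y : coinvariants (arcCoaction (polyCoaction (sumMat a b k))),
      Φ y ∈ (Algebra.TensorProduct.map A.val (AlgHom.id ℂ Theta)).range := by
    intro y
    obtain ⟨q, rfl⟩ := hsurj k y
    refine arcAlg_hom_mem (f := Φ.comp (arcMap (coinvariants _).val)) (fun r j => ?_) q
    have h1 : arcMap (coinvariants (polyCoaction (sumMat a b k))).val (arcCoeff r j) =
        arcCoeff (r : MvPolynomial (ι ⊕ Fin k × κ) ℂ) j := by simp [arcMap]
    rw [AlgHom.comp_apply, h1, hΦ, ← hg]
    generalize g r = z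
    induction z using TensorProduct.induction_on with
    | zero => simp
    | add z w hz hw => rw [map_add, map_add]; exact add_mem hz hw
    | tmul c t => exact ⟨⟨_, superArc_mem_diffAdjoin c.2 j⟩ ⊗ₜ t, rfl⟩
  have hmem : ∀ w : coinvariants (arcCoaction (polyCoaction (sumMat a b k))) ⊗[ℂ] Theta,
      contract _ φ (Algebra.TensorProduct.assoc ℂ ℂ ℂ (SuperPoly (ι × ℕ) (κ × ℕ)) Theta Theta
        (Algebra.TensorProduct.map Φ (AlgHom.id ℂ Theta)
          (Algebra.TensorProduct.map
            (coinvariants (arcCoaction (polyCoaction (sumMat a b k)))).val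
            (AlgHom.id ℂ Theta) w))) ∈ A := by
    intro w
    induction w using TensorProduct.induction_on with
    | zero => simp
    | add z w hz hw => simp only [map_add]; exact add_mem hz hw
    | tmul y t =>
      obtain ⟨v, hv⟩ := hΦA y
      rw [Algebra.TensorProduct.map_tmul, Algebra.TensorProduct.map_tmul, Subalgebra.coe_val, ← hv]
      clear hv
      induction v using TensorProduct.induction_on with
      | zero => simp
      | add z w hz hw =>
        simp only [map_add, RingHom.coe_coe, AlgHom.toRingHom_eq_coe,
          TensorProduct.add_tmul] at hz hw ⊢
        exact add_mem hz hw
      | tmul c t' =>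
        simp only [RingHom.coe_coe, AlgHom.toRingHom_eq_coe, Algebra.TensorProduct.map_tmul,
          AlgHom.id_apply, Algebra.TensorProduct.assoc_tmul, contract_tmul]
        exact A.smul_mem c.2 _
  have h1 := hmem (f ⟨x, hx⟩)
  rw [hf, arcRestitute_polarizeArc hΦ] at h1
  have h2 : contract _ φ (Algebra.TensorProduct.map (AlgHom.id ℂ _)
      (Polynomial.aeval (thetaSum k)) (scale (ι × ℕ) (κ × ℕ) x)) = x :=
    hφ.trans (contract_scale x)
  rwa [h2] at h1

theorem coinvariants_eq_diffAdjoin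
    (hsurj : ∀ k : ℕ, Function.Surjective (arcQuotientMap (polyCoaction (sumMat a b k)))) :
    coinvariants (arcSuperCoaction a b) =
      diffAdjoin (superD ι κ) (levelZero ι κ '' coinvariants (classicalCoaction a b)) := by
  refine le_antisymm (coinvariants_le_diffAdjoin a b hsurj)
    (diffAdjoin_le ?_ fun _ => superD_mem_coinvariants a b)
  rintro _ ⟨x, hx, rfl⟩
  exact levelZero_mem_coinvariants a b hx

theorem diffAdjoin_levelZero_adjoin {ι κ : Type*} (s : Set (SuperPoly ι κ)) :
    diffAdjoin (superD ι κ) (levelZero ι κ '' (Algebra.adjoin ℂ s : Subalgebra ℂ _)) =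
      diffAdjoin (superD ι κ) (levelZero ι κ '' s) := by
  refine le_antisymm (diffAdjoin_le ?_ fun _ => diffAdjoin_stable)
    (diffAdjoin_le ?_ fun _ => diffAdjoin_stable)
  · rintro _ ⟨x, hx, rfl⟩
    have h : Algebra.adjoin ℂ s ≤
        (diffAdjoin (superD ι κ) (levelZero ι κ '' s)).comap (levelZero ι κ) :=
      Algebra.adjoin_le fun y hy => subset_diffAdjoin ⟨y, hy, rfl⟩
    exact h hx
  · exact (Set.image_mono Algebra.subset_adjoin).trans subset_diffAdjoin

end Invariants

/-! ### Differential ideals -/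

section DiffIdeal

variable {B : Type*} [Ring B] [Algebra ℂ B] {D : B →ₗ[ℂ] B} {s : Set B}

theorem subset_diffIdeal : s ⊆ diffIdeal D s := fun _ hx =>
  (TwoSidedIdeal.mem_sInf _).2 fun _ hI => hI.1 hx

theorem diffIdeal_stable {x : B} (hx : x ∈ diffIdeal D s) : D x ∈ diffIdeal D s :=
  (TwoSidedIdeal.mem_sInf _).2 fun I hI => hI.2 x ((TwoSidedIdeal.mem_sInf _).1 hx I hI)

theorem diffIdeal_le {I : TwoSidedIdeal B} (h : s ⊆ I) (hD : ∀ a ∈ I, D a ∈ I) :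
    diffIdeal D s ≤ I := sInf_le ⟨h, hD⟩

theorem divPow_mem_diffIdeal {x : B} (hx : x ∈ diffIdeal D s) (j : ℕ) :
    divPow D j x ∈ diffIdeal D s :=
  divPow_mem (S := (diffIdeal D s).asIdeal.restrictScalars ℂ) (fun _ h => diffIdeal_stable h) hx j

end DiffIdeal

section Parity

variable {σ ν : Type*}

theorem IsSuperComm.exists_superLift {T : Type*} [Ring T] [Algebra ℂ T] {π : T →ₐ[ℂ] T}
    (h : IsSuperComm π) (a : σ → T) (ha : ∀ s, π (a s) = a s) (b : ν → T)
    (hb : ∀ n, π (b n) = -b n) :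
    ∃ f : SuperPoly σ ν →ₐ[ℂ] T, (∀ s, f (evenGen ν s) = a s) ∧ ∀ n, f (oddGen σ n) = b n :=
  ⟨superLift a (fun s => h.mem_center (ha s)) b (h.mul_self_linearCombination hb),
    superLift_evenGen _ _ _ _, superLift_oddGen _ _ _ _⟩

section SuperEval

variable {τ₀ τ₁ : Type*} (α₀ : τ₀ → SuperPoly σ ν) (α₁ : τ₁ → SuperPoly σ ν)
  (h₀ : ∀ t, IsEvenElt (α₀ t)) (h₁ : ∀ t, IsOddElt (α₁ t))

@[simp]
theorem superEval_evenGen (t : τ₀) : superEval α₀ h₀ α₁ h₁ (evenGen τ₁ t) = α₀ t :=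
  superLift_evenGen _ _ _ _ t

@[simp]
theorem superEval_oddGen (t : τ₁) : superEval α₀ h₀ α₁ h₁ (oddGen τ₀ t) = α₁ t :=
  superLift_oddGen _ _ _ _ t

theorem parity_superEval (x : SuperPoly τ₀ τ₁) :
    parity σ ν (superEval α₀ h₀ α₁ h₁ x) = superEval α₀ h₀ α₁ h₁ (parity τ₀ τ₁ x) := by
  suffices h : (parity σ ν).comp (superEval α₀ h₀ α₁ h₁) =
      (superEval α₀ h₀ α₁ h₁).comp (parity τ₀ τ₁) from DFunLike.congr_fun h x
  refine superPoly_hom_ext (fun s => ?_) fun n => ?_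
  · simpa [IsEvenElt] using h₀ s
  · simpa [IsOddElt] using h₁ n

theorem superEval_range :
    (superEval α₀ h₀ α₁ h₁).range = Algebra.adjoin ℂ (Set.range α₀ ∪ Set.range α₁) := by
  refine le_antisymm ?_ (Algebra.adjoin_le ?_)
  · rintro _ ⟨x, rfl⟩
    change superEval α₀ h₀ α₁ h₁ x ∈ _
    induction x using superPoly_induction_gen with
    | hc c => rw [AlgHom.commutes]; exact Subalgebra.algebraMap_mem _ c
    | heven s =>
      rw [superEval_evenGen]
      exact Algebra.subset_adjoin (Or.inl ⟨s, rfl⟩)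
    | hodd n =>
      rw [superEval_oddGen]
      exact Algebra.subset_adjoin (Or.inr ⟨n, rfl⟩)
    | hmul a b ha hb => rw [map_mul]; exact mul_mem ha hb
    | hadd a b ha hb => rw [map_add]; exact add_mem ha hb
  · rintro _ (⟨t, rfl⟩ | ⟨t, rfl⟩)
    · exact ⟨evenGen τ₁ t, superEval_evenGen _ _ _ _ t⟩
    · exact ⟨oddGen τ₀ t, superEval_oddGen _ _ _ _ t⟩

end SuperEval

theorem parity_polarizeFun {ι κ : Type*} {k : ℕ} (x : SuperPoly ι κ) :
    Algebra.TensorProduct.map (AlgHom.id ℂ _) (parity Empty ℕ) (polarizeFun ι κ k x) =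
      polarizeFun ι κ k (parity ι κ x) := by
  suffices h : (Algebra.TensorProduct.map (AlgHom.id ℂ _) (parity Empty ℕ)).comp
      (polarizeFun ι κ k) = (polarizeFun ι κ k).comp (parity ι κ) from DFunLike.congr_fun h x
  refine superPoly_hom_ext (fun s => ?_) fun n => ?_
  · simp [polarizeFun]
  · simp [polarizeFun, TensorProduct.tmul_neg]

theorem parity_scale (x : SuperPoly σ ν) :
    Algebra.TensorProduct.map (parity σ ν) (AlgHom.id ℂ _) (scale σ ν x) =
      scale σ ν (parity σ ν x) := by
  suffices h : (Algebra.TensorProduct.map (parity σ ν) (AlgHom.id ℂ _)).comp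
      (scale σ ν) = (scale σ ν).comp (parity σ ν) from DFunLike.congr_fun h x
  refine superPoly_hom_ext (fun s => ?_) fun n => ?_
  · simp
  · simp [TensorProduct.neg_tmul]

end Parity

section DiffEval

variable {ι κ τ₀ τ₁ : Type*} (α₀ : τ₀ → SuperPoly ι κ) (α₁ : τ₁ → SuperPoly ι κ)
  (h₀ : ∀ t, IsEvenElt (α₀ t)) (h₁ : ∀ t, IsOddElt (α₁ t))

/-- The homomorphism `D^j X_t ↦ D^j α_t`, for `α_t` of level zero. -/
def arcEval : SuperPoly (τ₀ × ℕ) (τ₁ × ℕ) →ₐ[ℂ] SuperPoly (ι × ℕ) (κ × ℕ) :=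
  diffEval (fun t => levelZero ι κ (α₀ t)) (fun t => (h₀ t).levelZero)
    (fun t => levelZero ι κ (α₁ t)) (fun t => (h₁ t).levelZero)

theorem arcEval_evenGen (s : τ₀ × ℕ) :
    arcEval α₀ α₁ h₀ h₁ (evenGen (τ₁ × ℕ) s) = superArc ι κ s.2 (α₀ s.1) :=
  (superLift_evenGen _ _ _ _ s).trans (divPow_apply _ _ _).symm

theorem arcEval_oddGen (s : τ₁ × ℕ) :
    arcEval α₀ α₁ h₀ h₁ (oddGen (τ₀ × ℕ) s) = superArc ι κ s.2 (α₁ s.1) :=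
  (superLift_oddGen _ _ _ _ s).trans (divPow_apply _ _ _).symm

theorem arcEval_superArc (j : ℕ) (x : SuperPoly τ₀ τ₁) :
    arcEval α₀ α₁ h₀ h₁ (superArc τ₀ τ₁ j x) =
      superArc ι κ j (superEval α₀ h₀ α₁ h₁ x) :=
  IsArc.superPoly_ext ((isArc_superArc τ₀ τ₁).comp (arcEval α₀ α₁ h₀ h₁))
    ((isArc_superArc ι κ).precomp (superEval α₀ h₀ α₁ h₁))
    (fun j s => by simp [arcEval_evenGen])
    (fun j n => by simp [arcEval_oddGen]) j x

theorem superArc_zero (x : SuperPoly ι κ) : superArc ι κ 0 x = levelZero ι κ x :=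
  divPow_zero _ _

theorem superD_superArc (j : ℕ) (x : SuperPoly ι κ) :
    superD ι κ (superArc ι κ j x) = ((j + 1 : ℕ) : ℂ) • superArc ι κ (j + 1) x :=
  apply_divPow _ _ _

theorem superD_arcEval (x : SuperPoly (τ₀ × ℕ) (τ₁ × ℕ)) :
    superD ι κ (arcEval α₀ α₁ h₀ h₁ x) = arcEval α₀ α₁ h₀ h₁ (superD τ₀ τ₁ x) := by
  induction x using superPoly_induction_gen with
  | hc c => rw [AlgHom.commutes, superD_algebraMap, superD_algebraMap, map_zero]
  | heven s => rw [arcEval_evenGen, superD_superArc, superD_evenGen, map_smul, arcEval_evenGen]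
  | hodd n =>
    obtain ⟨n, j⟩ := n
    rw [arcEval_oddGen, superD_superArc, superD_oddGen, map_smul, arcEval_oddGen]
  | hmul x y hx hy => rw [map_mul, superD_mul, superD_mul, map_add, map_mul, map_mul, hx, hy]
  | hadd x y hx hy => rw [map_add, map_add, map_add, map_add, hx, hy]

variable {α₀ α₁ h₀ h₁}

theorem diffIdeal_le_ker {F : Set (SuperPoly τ₀ τ₁)}
    (hF : TwoSidedIdeal.span F = TwoSidedIdeal.ker (superEval α₀ h₀ α₁ h₁)) :
    diffIdeal (superD τ₀ τ₁) (levelZero τ₀ τ₁ '' F) ≤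
      TwoSidedIdeal.ker (arcEval α₀ α₁ h₀ h₁) := by
  refine diffIdeal_le ?_ fun x hx => ?_
  · rintro _ ⟨x, hx, rfl⟩
    have h2 : x ∈ TwoSidedIdeal.ker (superEval α₀ h₀ α₁ h₁) :=
      hF ▸ TwoSidedIdeal.subset_span hx
    rw [TwoSidedIdeal.mem_ker] at h2
    rw [SetLike.mem_coe, TwoSidedIdeal.mem_ker, ← superArc_zero, arcEval_superArc, h2, map_zero]
  · rw [TwoSidedIdeal.mem_ker] at hx ⊢
    rw [← superD_arcEval, hx, map_zero]

/-- Relations among the `α_t` may be differentiated: `F` generates the ideal of all relations, and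
`levelZero` maps this ideal into the differential ideal of `F`. -/
theorem superArc_mem_diffIdeal {F : Set (SuperPoly τ₀ τ₁)}
    (hF : TwoSidedIdeal.span F = TwoSidedIdeal.ker (superEval α₀ h₀ α₁ h₁))
    {x : SuperPoly τ₀ τ₁} (hx : superEval α₀ h₀ α₁ h₁ x = 0) (j : ℕ) :
    superArc τ₀ τ₁ j x ∈ diffIdeal (superD τ₀ τ₁) (levelZero τ₀ τ₁ '' F) := by
  refine divPow_mem_diffIdeal ?_ j
  have h : TwoSidedIdeal.span F ≤
      (diffIdeal (superD τ₀ τ₁) (levelZero τ₀ τ₁ '' F)).comap (levelZero τ₀ τ₁) := by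
    rw [TwoSidedIdeal.span_le]
    exact fun y hy => (TwoSidedIdeal.mem_comap _).2 (subset_diffIdeal ⟨y, hy, rfl⟩)
  refine (TwoSidedIdeal.mem_comap (levelZero τ₀ τ₁)).1 (h ?_)
  rw [hF]
  exact (TwoSidedIdeal.mem_ker _).2 hx

/-- The differential ideal of `F` is stable under parity, although `F` need not be, because the
ideal of relations that `F` generates is. -/
theorem parity_mem_diffIdeal {F : Set (SuperPoly τ₀ τ₁)}
    (hF : TwoSidedIdeal.span F = TwoSidedIdeal.ker (superEval α₀ h₀ α₁ h₁))
    {x : SuperPoly (τ₀ × ℕ) (τ₁ × ℕ)}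
    (hx : x ∈ diffIdeal (superD τ₀ τ₁) (levelZero τ₀ τ₁ '' F)) :
    parity _ _ x ∈ diffIdeal (superD τ₀ τ₁) (levelZero τ₀ τ₁ '' F) := by
  have h : diffIdeal (superD τ₀ τ₁) (levelZero τ₀ τ₁ '' F) ≤
      (diffIdeal (superD τ₀ τ₁) (levelZero τ₀ τ₁ '' F)).comap (parity _ _) := by
    refine diffIdeal_le ?_ fun y hy => ?_
    · rintro _ ⟨y, hy, rfl⟩
      refine (TwoSidedIdeal.mem_comap _).2 ?_
      rw [parity_levelZero, ← superArc_zero]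
      refine superArc_mem_diffIdeal hF ?_ 0
      have h2 : y ∈ TwoSidedIdeal.ker (superEval α₀ h₀ α₁ h₁) :=
        hF ▸ TwoSidedIdeal.subset_span hy
      rw [TwoSidedIdeal.mem_ker] at h2
      rw [← parity_superEval, h2, map_zero]
    · refine (TwoSidedIdeal.mem_comap _).2 ?_
      rw [parity_superD]
      exact diffIdeal_stable ((TwoSidedIdeal.mem_comap _).1 hy)
  exact (TwoSidedIdeal.mem_comap _).1 (h hx)

end DiffEval

/-! ### Relations between the invariants -/

section Naturality

variable {A A' M M' K K' L : Type*} [Ring A] [Algebra ℂ A] [Ring A'] [Algebra ℂ A'] [Ring M]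
  [Algebra ℂ M] [Ring M'] [Algebra ℂ M'] [Ring K] [Algebra ℂ K] [Ring K'] [Algebra ℂ K']
  [Ring L] [Algebra ℂ L]

theorem map_rTensor_comm {γ : M →ₗ[ℂ] A} {γ' : M' →ₗ[ℂ] A'} {f : A →ₐ[ℂ] A'} {g : M →ₐ[ℂ] M'}
    (ψ : K →ₐ[ℂ] K') (h : ∀ m, f (γ m) = γ' (g m)) (w : M ⊗[ℂ] K) :
    Algebra.TensorProduct.map f ψ (γ.rTensor K w) =
      γ'.rTensor K' (Algebra.TensorProduct.map g ψ w) := by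
  induction w using TensorProduct.induction_on with
  | zero => simp
  | tmul m k => simp [h]
  | add x y hx hy => simp only [map_add, hx, hy]

theorem assoc_map_rTensor {γ : M →ₗ[ℂ] A} {γ' : M' →ₗ[ℂ] A'} {f : A →ₐ[ℂ] A' ⊗[ℂ] K}
    {g : M →ₐ[ℂ] M' ⊗[ℂ] K} (h : ∀ m, f (γ m) = γ'.rTensor K (g m)) (w : M ⊗[ℂ] L) :
    Algebra.TensorProduct.assoc ℂ ℂ ℂ A' K L
        (Algebra.TensorProduct.map f (AlgHom.id ℂ L) (γ.rTensor L w)) =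
      γ'.rTensor (K ⊗[ℂ] L) (Algebra.TensorProduct.assoc ℂ ℂ ℂ M' K L
        (Algebra.TensorProduct.map g (AlgHom.id ℂ L) w)) := by
  induction w using TensorProduct.induction_on with
  | zero => simp
  | add x y hx hy => simp only [map_add, hx, hy]
  | tmul m l =>
    rw [LinearMap.rTensor_tmul, Algebra.TensorProduct.map_tmul, Algebra.TensorProduct.map_tmul, h]
    generalize g m = z
    induction z using TensorProduct.induction_on with
    | zero => simp
    | add x y hx hy => simp only [map_add, TensorProduct.add_tmul, hx, hy]
    | tmul m k => simp

end Naturality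

section Relations

variable {ι κ τ₀ τ₁ : Type*}

/-- The super arc algebra of `C`: the quotient of the differential superpolynomials by the
differential ideal of `F` is supercommutative and carries a parity-preserving arc family of `C`. -/
theorem exists_arc_quotient {α₀ : τ₀ → SuperPoly ι κ} {α₁ : τ₁ → SuperPoly ι κ}
    {h₀ : ∀ t, IsEvenElt (α₀ t)} {h₁ : ∀ t, IsOddElt (α₁ t)} {C : Subalgebra ℂ (SuperPoly ι κ)}
    (hC : Algebra.adjoin ℂ (Set.range α₀ ∪ Set.range α₁) = C) {F : Set (SuperPoly τ₀ τ₁)}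
    (hF : TwoSidedIdeal.span F = TwoSidedIdeal.ker (superEval α₀ h₀ α₁ h₁)) :
    let J := SuperPoly (τ₀ × ℕ) (τ₁ × ℕ) ⧸
      (diffIdeal (superD τ₀ τ₁) (levelZero τ₀ τ₁ '' F)).asIdeal
    ∃ (π : J →ₐ[ℂ] J) (γ : ℕ → C →ₗ[ℂ] J), IsSuperComm π ∧ IsArc γ ∧
      (∀ j (x : SuperPoly τ₀ τ₁) (c : C), superEval α₀ h₀ α₁ h₁ x = c →
        γ j c = Ideal.Quotient.mkₐ ℂ _ (superArc τ₀ τ₁ j x)) ∧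
      ∀ j (c c' : C), parity ι κ c = c' → π (γ j c) = γ j c' := by
  intro J
  let I := (diffIdeal (superD τ₀ τ₁) (levelZero τ₀ τ₁ '' F)).asIdeal
  let mk : SuperPoly (τ₀ × ℕ) (τ₁ × ℕ) →ₐ[ℂ] J := Ideal.Quotient.mkₐ ℂ I
  have hmk : ∀ {x}, x ∈ I → mk x = 0 := fun h => Ideal.Quotient.eq_zero_iff_mem.2 h
  let π : J →ₐ[ℂ] J := Ideal.Quotient.liftₐ I (mk.comp (parity _ _)) fun x hx =>
    hmk (parity_mem_diffIdeal hF hx)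
  have hπ : ∀ x, π (mk x) = mk (parity _ _ x) := fun x => rfl
  have hmem : ∀ x, superEval α₀ h₀ α₁ h₁ x ∈ C := fun x => by
    rw [← hC, ← superEval_range α₀ α₁ h₀ h₁]
    exact ⟨x, rfl⟩
  let ev : SuperPoly τ₀ τ₁ →ₐ[ℂ] C := (superEval α₀ h₀ α₁ h₁).codRestrict C hmem
  have hev : Function.Surjective ev := by
    rintro ⟨c, hc⟩
    rw [← hC, ← superEval_range α₀ α₁ h₀ h₁] at hc
    obtain ⟨x, hx⟩ := hc
    exact ⟨x, Subtype.ext hx⟩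
  -- The arc family is defined through a linear section of `ev`; its choice does not matter modulo
  -- the differential ideal.
  obtain ⟨s, hs⟩ := LinearMap.exists_rightInverse_of_surjective ev.toLinearMap
    (LinearMap.range_eq_top.2 hev)
  let γ : ℕ → C →ₗ[ℂ] J := fun j => mk.toLinearMap ∘ₗ superArc τ₀ τ₁ j ∘ₗ s
  have hγ : ∀ j (x : SuperPoly τ₀ τ₁) (c : C), superEval α₀ h₀ α₁ h₁ x = c →
      γ j c = mk (superArc τ₀ τ₁ j x) := by
    intro j x c hx
    have h1 : superEval α₀ h₀ α₁ h₁ (s c) = c := congrArg Subtype.val (LinearMap.congr_fun hs c)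
    have h2 := hmk (superArc_mem_diffIdeal hF
      (show superEval α₀ h₀ α₁ h₁ (s c - x) = 0 by rw [map_sub, h1, hx, sub_self]) j)
    rw [map_sub, map_sub] at h2
    exact sub_eq_zero.1 h2
  refine ⟨π, γ, (isSuperComm_parity _ _).of_surjective mk Ideal.Quotient.mk_surjective hπ,
    ⟨fun j => ?_, fun r t j => ?_⟩, hγ, fun j c c' hc => ?_⟩
  · rw [hγ j 1 1 (map_one _), (isArc_superArc _ _).one, apply_ite mk, map_one, map_zero]
  · obtain ⟨x, rfl⟩ := hev r
    obtain ⟨y, rfl⟩ := hev t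
    rw [hγ j (x * y) _ (map_mul _ x y), (isArc_superArc _ _).mul, map_sum]
    refine Finset.sum_congr rfl fun q _ => ?_
    rw [map_mul, hγ q.1 x _ rfl, hγ q.2 y _ rfl]
  · obtain ⟨x, rfl⟩ := hev c
    rw [hγ j x _ rfl, hπ, parity_superArc, hγ j (parity _ _ x)]
    rw [← hc, ← parity_superEval]
    rfl

variable {H : Type*} [Fintype ι] [Fintype κ] [CommRing H] [Algebra ℂ H]
  {a : Matrix ι ι H} {b : Matrix κ κ H}

theorem parity_mem_coinvariants {x : SuperPoly ι κ}
    (hx : x ∈ coinvariants (classicalCoaction a b)) :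
    parity ι κ x ∈ coinvariants (classicalCoaction a b) := by
  have h : (classicalCoaction a b).comp (parity ι κ) =
      (Algebra.TensorProduct.map (AlgHom.id ℂ H) (parity ι κ)).comp (classicalCoaction a b) := by
    refine superPoly_hom_ext (fun s => ?_) fun n => ?_
    · simp [classicalCoaction_evenGen]
    · simp [classicalCoaction_oddGen, TensorProduct.tmul_neg]
  have h2 : classicalCoaction a b x = 1 ⊗ₜ x := hx
  have h3 := DFunLike.congr_fun h x
  rw [AlgHom.comp_apply, AlgHom.comp_apply, h2] at h3
  exact h3

/-- If the arc space of every `(Ũ ⊕ U^k) // G` embeds, then every relation among the derivatives of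
invariants `α_t` holds in each supercommutative algebra with an arc family of the invariants. -/
theorem eq_zero_of_arcEval_eq_zero
    (hinj : ∀ k : ℕ, Function.Injective (arcQuotientMap (polyCoaction (sumMat a b k))))
    {J : Type*} [Ring J] [Algebra ℂ J] {π : J →ₐ[ℂ] J} (hπ : IsSuperComm π)
    {γ : ℕ → coinvariants (classicalCoaction a b) →ₗ[ℂ] J} (hγ : IsArc γ)
    (hγπ : ∀ j (c c' : coinvariants (classicalCoaction a b)), parity ι κ c = c' →
      π (γ j c) = γ j c')
    (α₀ : τ₀ → coinvariants (classicalCoaction a b))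
    (α₁ : τ₁ → coinvariants (classicalCoaction a b))
    (h₀ : ∀ t, IsEvenElt (α₀ t : SuperPoly ι κ)) (h₁ : ∀ t, IsOddElt (α₁ t : SuperPoly ι κ))
    {f : SuperPoly (τ₀ × ℕ) (τ₁ × ℕ) →ₐ[ℂ] J}
    (hf₀ : ∀ s, f (evenGen (τ₁ × ℕ) s) = γ s.2 (α₀ s.1))
    (hf₁ : ∀ s, f (oddGen (τ₀ × ℕ) s) = γ s.2 (α₁ s.1))
    {z : SuperPoly (τ₀ × ℕ) (τ₁ × ℕ)}
    (hz : arcEval (fun t => (α₀ t : SuperPoly ι κ)) (fun t => (α₁ t : SuperPoly ι κ)) h₀ h₁ z =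
      0) :
    f z = 0 := by
  let C := coinvariants (classicalCoaction a b)
  let πC : C →ₐ[ℂ] C := ((parity ι κ).comp C.val).codRestrict C fun c =>
    parity_mem_coinvariants c.2
  -- The scaling homomorphism of the super arc algebra.
  obtain ⟨g, hg⟩ := exists_coinvariants_restrict _ _ _ (scale_equivariant a b)
  have hgπ : ∀ j (c c' : C), parity ι κ c = c' →
      Algebra.TensorProduct.map π (AlgHom.id ℂ (Polynomial ℂ)) ((γ j).rTensor _ (g c)) =
        (γ j).rTensor _ (g c') := by
    intro j c c' hc
    rw [map_rTensor_comm (g := πC) (γ' := γ j) _ fun m => hγπ j m (πC m) rfl]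
    congr 1
    refine coinvariants_map_injective _ _ ?_
    refine (map_rTensor_comm (γ := C.val.toLinearMap) (γ' := C.val.toLinearMap) (f := parity ι κ)
      (g := πC) (AlgHom.id ℂ (Polynomial ℂ)) (fun _ => rfl) (g c)).symm.trans ?_
    refine (congrArg _ (hg c)).trans ?_
    rw [parity_scale, hc, hg]
  obtain ⟨G, hG₀, hG₁⟩ := (hπ.tensor_right (Polynomial ℂ)).exists_superLift
    (fun s : τ₀ × ℕ => (γ s.2).rTensor (Polynomial ℂ) (g (α₀ s.1)))
    (fun s => hgπ _ _ _ (h₀ s.1))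
    (fun s : τ₁ × ℕ => (γ s.2).rTensor (Polynomial ℂ) (g (α₁ s.1)))
    (fun s => by
      rw [hgπ _ _ (-α₁ s.1) (h₁ s.1), map_neg, map_neg])
  have hcg : ∀ j c, contract J (Polynomial.aeval (1 : ℂ)).toLinearMap ((γ j).rTensor _ (g c)) =
      γ j c := by
    intro j c
    rw [contract_rTensor]
    congr 1
    refine Subtype.ext ?_
    have h := contract_scale (c : SuperPoly ι κ)
    rw [← hg c] at h
    refine Eq.trans ?_ h
    exact (contract_rTensor _ C.val.toLinearMap (g c)).symm
  have hfG : ∀ x, contract J (Polynomial.aeval (1 : ℂ)).toLinearMap (G x) = f x := by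
    intro x
    rw [contract_aeval_eq]
    suffices h : ((Algebra.TensorProduct.rid ℂ ℂ J).toAlgHom.comp
        (Algebra.TensorProduct.map (AlgHom.id ℂ J) (Polynomial.aeval (1 : ℂ)))).comp G = f from
      DFunLike.congr_fun h x
    refine superPoly_hom_ext (fun s => ?_) fun s => ?_
    · rw [AlgHom.comp_apply, ← contract_aeval_eq, hG₀, hf₀, hcg]
    · rw [AlgHom.comp_apply, ← contract_aeval_eq, hG₁, hf₁, hcg]
  obtain ⟨k, φ, hφ⟩ := exists_contract_thetaSum (G z)
  rw [hfG] at hφ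
  rw [← hφ]
  -- Polarization and restitution of the invariants.
  obtain ⟨p, hp⟩ := exists_coinvariants_restrict _ _ _ (polarizeFun_equivariant a b k)
  obtain ⟨q, hq⟩ := exists_coinvariants_restrict _ _ _ (restitute_equivariant a b k)
  let R := coinvariants (polyCoaction (sumMat a b k))
  obtain ⟨Ψ, hΨ⟩ := ((hγ.rTensor Theta).precomp q).exists_lift fun i j r s => by
    have hqπ : ∀ r, Algebra.TensorProduct.map πC (parity Empty ℕ) (q r) = q r := by
      intro r
      refine coinvariants_map_injective _ _ ?_
      refine (map_rTensor_comm (γ := C.val.toLinearMap) (γ' := C.val.toLinearMap) (f := parity ι κ)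
        (g := πC) (parity Empty ℕ) (fun _ => rfl) (q r)).symm.trans ?_
      refine (congrArg _ (hq r)).trans ?_
      rw [parity_restitute, hq]
    refine hπ.commute_tensor (isSuperComm_parity Empty ℕ) ?_ ?_ <;>
      exact (map_rTensor_comm (g := πC) _ (fun m => hγπ _ m (πC m) rfl) _).trans
        (congrArg _ (hqπ _))
  have hpπ : ∀ j (c c' : C), parity ι κ c = c' →
      Algebra.TensorProduct.map (AlgHom.id ℂ (ArcAlg R)) (parity Empty ℕ)
        ((arcFam R j).rTensor _ (p c)) = (arcFam R j).rTensor _ (p c') := by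
    intro j c c' hc
    rw [map_rTensor_comm (g := AlgHom.id ℂ R) (γ' := arcFam R j) _ fun m => rfl]
    congr 1
    refine coinvariants_map_injective _ _ ?_
    refine (map_rTensor_comm (γ := R.val.toLinearMap) (γ' := R.val.toLinearMap)
      (f := AlgHom.id ℂ _) (g := AlgHom.id ℂ R) (parity Empty ℕ) (fun _ => rfl) (p c)).symm.trans ?_
    refine (congrArg _ (hp c)).trans ?_
    rw [parity_polarizeFun, hc, hp]
  obtain ⟨P, hP₀, hP₁⟩ := ((isSuperComm_parity Empty ℕ).tensor_left (ArcAlg R)).exists_superLift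
    (fun s : τ₀ × ℕ => (arcFam R s.2).rTensor Theta (p (α₀ s.1)))
    (fun s => hpπ _ _ _ (h₀ s.1))
    (fun s : τ₁ × ℕ => (arcFam R s.2).rTensor Theta (p (α₁ s.1)))
    (fun s => by
      rw [hpπ _ _ (-α₁ s.1) (h₁ s.1), map_neg, map_neg])
  -- A relation dies already in the arc algebra of the quotient.
  have hPz : P z = 0 := by
    have harc : ∀ x, Algebra.TensorProduct.map (arcMap R.val) (AlgHom.id ℂ Theta) (P x) =
        polarizeArc ι κ k (arcEval (fun t => (α₀ t : SuperPoly ι κ))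
          (fun t => (α₁ t : SuperPoly ι κ)) h₀ h₁ x) := by
      have key : ∀ j c, Algebra.TensorProduct.map (arcMap R.val) (AlgHom.id ℂ Theta)
          ((arcFam R j).rTensor _ (p c)) = polarizeArc ι κ k (superArc ι κ j c) := by
        intro j c
        rw [polarizeArc_superArc, ← hp]
        exact map_rTensor_comm _ (fun r => by simp [arcMap]) _
      intro x
      suffices h : (Algebra.TensorProduct.map (arcMap R.val) (AlgHom.id ℂ Theta)).comp P =
          (polarizeArc ι κ k).comp (arcEval (fun t => (α₀ t : SuperPoly ι κ))
            (fun t => (α₁ t : SuperPoly ι κ)) h₀ h₁) from DFunLike.congr_fun h x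
      refine superPoly_hom_ext (fun s => ?_) fun s => ?_
      · rw [AlgHom.comp_apply, AlgHom.comp_apply, arcEval_evenGen, hP₀, key]
      · rw [AlgHom.comp_apply, AlgHom.comp_apply, arcEval_oddGen, hP₁, key]
    have hinj' : Function.Injective (arcMap R.val) := fun x y h => hinj k (Subtype.ext h)
    refine rTensor_injective_of_field Theta (f := (arcMap R.val).toLinearMap) hinj' ?_
    rw [map_zero]
    refine (harc z).trans ?_
    rw [hz, map_zero]
  -- Restitution after polarization is the scaling homomorphism.
  have hPG : ∀ x, Algebra.TensorProduct.assoc ℂ ℂ ℂ _ _ _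
      (Algebra.TensorProduct.map Ψ (AlgHom.id ℂ Theta) (P x)) =
        Algebra.TensorProduct.map (AlgHom.id ℂ J) (Polynomial.aeval (thetaSum k)) (G x) := by
    have hqp : ∀ c, Algebra.TensorProduct.assoc ℂ ℂ ℂ _ _ _
        (Algebra.TensorProduct.map q (AlgHom.id ℂ Theta) (p c)) =
          Algebra.TensorProduct.map (AlgHom.id ℂ C) (Polynomial.aeval (thetaSum k)) (g c) := by
      intro c
      refine coinvariants_map_injective _ _ ?_
      refine (assoc_map_rTensor (γ := R.val.toLinearMap) (γ' := C.val.toLinearMap)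
        (f := restitute ι κ k) (fun r => (hq r).symm) (p c)).symm.trans ?_
      refine (congrArg (fun y => Algebra.TensorProduct.assoc ℂ ℂ ℂ _ _ _
        (Algebra.TensorProduct.map (restitute ι κ k) (AlgHom.id ℂ Theta) y)) (hp c)).trans ?_
      refine (restitute_polarizeFun _).trans ?_
      rw [← hg]
      exact map_rTensor_comm (γ := C.val.toLinearMap) (γ' := C.val.toLinearMap)
        (f := AlgHom.id ℂ _) (g := AlgHom.id ℂ C) _ (fun _ => rfl) (g c)
    have key : ∀ j c, Algebra.TensorProduct.assoc ℂ ℂ ℂ _ _ _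
        (Algebra.TensorProduct.map Ψ (AlgHom.id ℂ Theta) ((arcFam R j).rTensor _ (p c))) =
          Algebra.TensorProduct.map (AlgHom.id ℂ J) (Polynomial.aeval (thetaSum k))
            ((γ j).rTensor _ (g c)) := by
      intro j c
      rw [assoc_map_rTensor (γ' := γ j) (g := q)
        fun r => (congrArg Ψ (arcFam_apply R j r)).trans (hΨ r j), hqp]
      exact (map_rTensor_comm (f := AlgHom.id ℂ _) (g := AlgHom.id ℂ C) _ (fun _ => rfl) _).symm
    intro x
    suffices h : ((Algebra.TensorProduct.assoc ℂ ℂ ℂ _ _ _).toAlgHom.comp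
        (Algebra.TensorProduct.map Ψ (AlgHom.id ℂ Theta))).comp P =
          (Algebra.TensorProduct.map (AlgHom.id ℂ J) (Polynomial.aeval (thetaSum k))).comp G from
      DFunLike.congr_fun h x
    refine superPoly_hom_ext (fun s => ?_) fun s => ?_
    · rw [AlgHom.comp_apply, AlgHom.comp_apply, AlgHom.comp_apply, hP₀, hG₀]
      exact key _ _
    · rw [AlgHom.comp_apply, AlgHom.comp_apply, AlgHom.comp_apply, hP₁, hG₁]
      exact key _ _
  have h := hPG z
  rw [hPz, map_zero, map_zero] at h
  have h2 : contract J φ (Algebra.TensorProduct.map (AlgHom.id ℂ J)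
      (Polynomial.aeval (thetaSum k)) (G z)) = 0 := by rw [← h, map_zero]
  exact h2

theorem ker_arcEval_eq_diffIdeal
    (hinj : ∀ k : ℕ, Function.Injective (arcQuotientMap (polyCoaction (sumMat a b k))))
    {α₀ : τ₀ → SuperPoly ι κ} {α₁ : τ₁ → SuperPoly ι κ}
    {h₀ : ∀ t, IsEvenElt (α₀ t)} {h₁ : ∀ t, IsOddElt (α₁ t)}
    (hC : Algebra.adjoin ℂ (Set.range α₀ ∪ Set.range α₁) = coinvariants (classicalCoaction a b))
    {F : Set (SuperPoly τ₀ τ₁)}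
    (hF : TwoSidedIdeal.span F = TwoSidedIdeal.ker (superEval α₀ h₀ α₁ h₁)) :
    TwoSidedIdeal.ker (arcEval α₀ α₁ h₀ h₁) =
      diffIdeal (superD τ₀ τ₁) (levelZero τ₀ τ₁ '' F) := by
  refine le_antisymm (fun z hz => ?_) (diffIdeal_le_ker hF)
  obtain ⟨π, γ, hπ, hγ, hγ', hγπ⟩ := exists_arc_quotient hC hF
  have hα₀ : ∀ t, α₀ t ∈ coinvariants (classicalCoaction a b) :=
    fun t => hC ▸ Algebra.subset_adjoin (Or.inl ⟨t, rfl⟩)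
  have hα₁ : ∀ t, α₁ t ∈ coinvariants (classicalCoaction a b) :=
    fun t => hC ▸ Algebra.subset_adjoin (Or.inr ⟨t, rfl⟩)
  have h := eq_zero_of_arcEval_eq_zero hinj hπ hγ hγπ
    (fun t => ⟨α₀ t, hα₀ t⟩) (fun t => ⟨α₁ t, hα₁ t⟩) h₀ h₁
    (f := Ideal.Quotient.mkₐ ℂ _)
    (fun s => by
      rw [hγ' s.2 (evenGen τ₁ s.1) ⟨α₀ s.1, hα₀ s.1⟩ (superEval_evenGen _ _ _ _ _),
        superArc_evenGen])
    (fun s => by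
      rw [hγ' s.2 (oddGen τ₀ s.1) ⟨α₁ s.1, hα₁ s.1⟩ (superEval_oddGen _ _ _ _ _),
        superArc_oddGen])
    ((TwoSidedIdeal.mem_ker _).1 hz)
  exact Ideal.Quotient.eq_zero_iff_mem.1 h

end Relations

end ArcSuper

theorem mainTheorem7 {H : Type*} [CommRing H] [HopfAlgebra ℂ H] [Algebra.FiniteType ℂ H]
    {V U : Type*} [AddCommGroup V] [Module ℂ V] [AddCommGroup U] [Module ℂ U]
    (ρV : ArcSuper.GModule H V) (ρU : ArcSuper.GModule H U)
    {ι κ : Type*} [Fintype ι] [Fintype κ]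
    (bV : Module.Basis ι ℂ V) (bU : Module.Basis κ ℂ U) :
    ((∀ k : ℕ, Function.Surjective (ArcSuper.arcQuotientMap
        (ArcSuper.polyCoaction (ArcSuper.sumMat (ρV.mat bV) (ρU.mat bU) k)))) →
      ArcSuper.coinvariants (ArcSuper.arcSuperCoaction (ρV.mat bV) (ρU.mat bU)) =
        ArcSuper.diffAdjoin (ArcSuper.superD ι κ) (ArcSuper.levelZero ι κ ''
          ArcSuper.coinvariants (ArcSuper.classicalCoaction (ρV.mat bV) (ρU.mat bU))) ∧
      ∀ s : Set (ArcSuper.SuperPoly ι κ),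
        Algebra.adjoin ℂ s =
          ArcSuper.coinvariants (ArcSuper.classicalCoaction (ρV.mat bV) (ρU.mat bU)) →
        ArcSuper.coinvariants (ArcSuper.arcSuperCoaction (ρV.mat bV) (ρU.mat bU)) =
          ArcSuper.diffAdjoin (ArcSuper.superD ι κ) (ArcSuper.levelZero ι κ '' s)) ∧
    ((∀ k : ℕ, Function.Bijective (ArcSuper.arcQuotientMap
        (ArcSuper.polyCoaction (ArcSuper.sumMat (ρV.mat bV) (ρU.mat bU) k)))) →
      ∀ {τ₀ τ₁ : Type*} (α₀ : τ₀ → ArcSuper.SuperPoly ι κ) (α₁ : τ₁ → ArcSuper.SuperPoly ι κ)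
        (h₀ : ∀ t, ArcSuper.IsEvenElt (α₀ t)) (h₁ : ∀ t, ArcSuper.IsOddElt (α₁ t)),
        Algebra.adjoin ℂ (Set.range α₀ ∪ Set.range α₁) =
          ArcSuper.coinvariants (ArcSuper.classicalCoaction (ρV.mat bV) (ρU.mat bU)) →
        ∀ F : Set (ArcSuper.SuperPoly τ₀ τ₁),
          TwoSidedIdeal.span F = TwoSidedIdeal.ker (ArcSuper.superEval α₀ h₀ α₁ h₁) →
          TwoSidedIdeal.ker (ArcSuper.diffEval
              (fun t => ArcSuper.levelZero ι κ (α₀ t)) (fun t => (h₀ t).levelZero)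
              (fun t => ArcSuper.levelZero ι κ (α₁ t)) (fun t => (h₁ t).levelZero)) =
            ArcSuper.diffIdeal (ArcSuper.superD τ₀ τ₁) (ArcSuper.levelZero τ₀ τ₁ '' F)) := by
  refine ⟨fun hsurj => ?_, fun hbij τ₀ τ₁ α₀ α₁ h₀ h₁ hC F hF =>
    ArcSuper.ker_arcEval_eq_diffIdeal (fun k => (hbij k).1) hC hF⟩
  have h := ArcSuper.coinvariants_eq_diffAdjoin _ _ hsurj
  refine ⟨h, fun s hs => ?_⟩
  rw [h, ← hs, ArcSuper.diffAdjoin_levelZero_adjoin]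

end
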